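/- Let $\lambda_b>0$, $R=(\pi\lambda_b)^{-1/2}$, $\mathcal A=B(0,R)\subset\mathbb R^2$, $\tau>2$, $\delta=2/\tau$, $\mu>0$, $\bar w>0$, $s>0$. On a probability space let $X_0,X_1,\dots$ be random points of the plane which form, on $\mathcal A^c$, a homogeneous Poisson point process of intensity $\lambda_b$, and let $(L_j,G_j)_{j\ge 0}$ be i.i.d. pairs, independent of $(X_j)_j$, where for each $j$ the variables $L_j$ and $G_j$ are independent and $L_j$ has density $2\pi\lambda_b x$ on $[0,R]$. Put $$I_c=\sum_{j:\,X_j\in\mathcal A^c} L_j^{\tau}\,G_j\,\|X_j\|^{-\tau}.$$ Write $I_\nu$ for the modified Bessel function of the first kind and $$G^{2,1}_{2,2}\!\left(z\,\Big|\,{a_1,a_2\atop b_1,b_2}\right)=\frac1{2\pi i}\int_{c-i\infty}^{c+i\infty}\frac{\Gamma(b_1-u)\Gamma(b_2-u)\Gamma(1-a_1+u)}{\Gamma(a_2-u)}z^u\,du,\qquad a_1-1<c<\min(b_1,b_2),$$ for the Meijer $G$-function. Assume one of the following. ($\kappa$-$\mu$ fading) $\kappa>0$, each $G_j$ has on $(0,\infty)$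 the density $$\frac{\mu}{\kappa^{\frac{\mu-1}2}e^{\mu\kappa}}\Big(\frac{1+\kappa}{\bar w}\Big)^{\frac{\mu+1}2}x^{\frac{\mu-1}2}\exp\Big(-\frac{\mu(1+\kappa)}{\bar w}x\Big)I_{\mu-1}\Big(2\mu\sqrt{\tfrac{\kappa(1+\kappa)}{\bar w}x}\Big),$$ and $$\varphi(r)=\frac{\pi\lambda_b r^2\delta}{e^{\mu\kappa}}\Big(\frac{\mu(1+\kappa)}{s\bar w}\Big)^{\delta}\sum_{n=0}^\infty\frac{(\mu\kappa)^n}{n!\,\Gamma(\mu+n)}\,G^{2,1}_{2,2}\!\left(\frac{\mu(1+\kappa)(\pi\lambda_b)^{1/\delta}r^{\tau}}{s\bar w}\,\Big|\,{1-\delta,\;1\atop 0,\;n+\mu-\delta}\right).$$ ($\eta$-$\mu$ fading) $\eta>0$, $h=\frac{2+\eta^{-1}+\eta}4$, $H=\frac{\eta^{-1}-\eta}4$, each $G_j$ has on $(0,\infty)$ the density $$\frac{2\sqrt\pi\,\mu^{\mu+\frac12}h^\mu}{\Gamma(\mu)H^{\mu-\frac12}\bar w^{\mu+\frac12}}x^{\mu-\frac12}\exp\Big(-\frac{2\mu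 hx}{\bar w}\Big)I_{\mu-\frac12}\Big(\frac{2\mu Hx}{\bar w}\Big)$$ (where $H^{-(\mu-\frac12)}I_{\mu-\frac12}(2\mu Hx/\bar w)$ is read as an even entire function of $H$, which covers $\eta\ge1$), and $$\varphi(r)=\frac{2\pi^{3/2}\lambda_b r^2\delta}{\Gamma(\mu)h^\mu}\Big(\frac{2\mu h}{s\bar w}\Big)^{\delta}\sum_{n=0}^\infty\frac{2^{-2n-2\mu}}{n!\,\Gamma(\mu+n+\frac12)}\Big(\frac Hh\Big)^{2n}G^{2,1}_{2,2}\!\left(\frac{2\mu h(\pi\lambda_b)^{1/\delta}r^{\tau}}{s\bar w}\,\Big|\,{1-\delta,\;1\atop 0,\;2n+2\mu-\delta}\right).$$ Then in either case $I_c<\infty$ almost surely; for every $r\ge R$ the integrals defining the Meijer functions converge absolutely, to values independent of $c$, and the series in $\varphi(r)$ converges; the function $(1-\varphi(r))r$ is integrable on $(R,\infty)$; and $$\mathbb E\big[e^{-sI_c}\big]=\exp\Big(-2\pi\lambda_b\int_R^\infty(1-\varphi(r))\,r\,dr\Big).$$ -/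

import Mathlib

open MeasureTheory ProbabilityTheory

noncomputable section

/-! ### Special functions -/

/-- The entire part of the modified Bessel function of the first kind,
`∑ₖ (z/2)^(2k) / (k! Γ(k+ν+1))`. -/
def besselISeries (nu z : ℝ) : ℝ :=
  ∑' k : ℕ, (z / 2) ^ (2 * k) / ((Nat.factorial k : ℝ) * Real.Gamma (k + nu + 1))

/-- Modified Bessel function of the first kind `I_ν(z)`, for `z > 0`. -/
def besselI (nu z : ℝ) : ℝ :=
  (z / 2) ^ nu * besselISeries nu z

/-- Integrand of the Mellin–Barnes integral of the Meijer function `G^{m,n}_{p,q}(z | a; b)`: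
`∏_{j≤m} Γ(b_j-u) ∏_{j≤n} Γ(1-a_j+u) / (∏_{j>m} Γ(1-b_j+u) ∏_{j>n} Γ(a_j-u)) · z^u`.
(The reciprocal of Mathlib's `Complex.Gamma` is `0` at the poles, as it should be.) -/
def meijerGIntegrand {p q : ℕ} (m n : ℕ) (a : Fin p → ℂ) (b : Fin q → ℂ) (z u : ℂ) : ℂ :=
  (∏ j : Fin q,
      if (j : ℕ) < m then Complex.Gamma (b j - u) else (Complex.Gamma (1 - b j + u))⁻¹) *
    (∏ j : Fin p,
      if (j : ℕ) < n then Complex.Gamma (1 - a j + u) else (Complex.Gamma (a j - u))⁻¹) *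
    z ^ u

/-- The vertical line `Re u = c` separates the poles of `Γ(b_j-u)`, `j ≤ m` (on its right) from
those of `Γ(1-a_j+u)`, `j ≤ n` (on its left). -/
def MeijerGSeparates {p q : ℕ} (m n : ℕ) (a : Fin p → ℂ) (b : Fin q → ℂ) (c : ℝ) : Prop :=
  (∀ j : Fin q, (j : ℕ) < m → c < (b j).re) ∧ (∀ j : Fin p, (j : ℕ) < n → (a j).re - 1 < c)

/-- The Mellin–Barnes integral `(2πi)⁻¹ ∫ … du` along the upward line `Re u = c`. -/
def meijerGLine {p q : ℕ} (m n : ℕ) (a : Fin p → ℂ) (b : Fin q → ℂ) (z : ℂ) (c : ℝ) : ℂ :=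
  (2 * (Real.pi : ℂ))⁻¹ * ∫ t : ℝ, meijerGIntegrand m n a b z ((c : ℂ) + (t : ℂ) * Complex.I)

open Classical in
/-- The Meijer function `G^{m,n}_{p,q}(z | a; b)` for parameters whose two families of poles can be
separated by a vertical line: the Mellin–Barnes integral along such a line. -/
def meijerG {p q : ℕ} (m n : ℕ) (a : Fin p → ℂ) (b : Fin q → ℂ) (z : ℂ) : ℂ :=
  if h : ∃ c : ℝ, MeijerGSeparates m n a b c then meijerGLine m n a b z h.choose else 0

/-- `meijerG m n a b z` is a genuine value: a separating line exists, and along every separating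
line the Mellin–Barnes integral converges absolutely, to this same value. -/
def MeijerGWellDefined {p q : ℕ} (m n : ℕ) (a : Fin p → ℂ) (b : Fin q → ℂ) (z : ℂ) : Prop :=
  (∃ c : ℝ, MeijerGSeparates m n a b c) ∧
    ∀ c : ℝ, MeijerGSeparates m n a b c →
      Integrable (fun t : ℝ => meijerGIntegrand m n a b z ((c : ℂ) + (t : ℂ) * Complex.I)) ∧
        meijerGLine m n a b z c = meijerG m n a b z

/-! ### Fading distributions -/

/-- Density of the `κ`-`μ` distribution with mean `w`. -/
def kappaMuPDF (kappa mu w x : ℝ) : ℝ :=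
  if 0 < x then
    mu / (kappa ^ ((mu - 1) / 2) * Real.exp (mu * kappa)) *
      ((1 + kappa) / w) ^ ((mu + 1) / 2) * x ^ ((mu - 1) / 2) *
      Real.exp (-(mu * (1 + kappa) / w * x)) *
      besselI (mu - 1) (2 * mu * Real.sqrt (kappa * (1 + kappa) / w * x))
  else 0

/-- The law of a `κ`-`μ` fading power coefficient. -/
def kappaMuLaw (kappa mu w : ℝ) : Measure ℝ :=
  volume.withDensity fun x => ENNReal.ofReal (kappaMuPDF kappa mu w x)

/-- `h = (2 + η⁻¹ + η)/4`. -/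
def etaMuh (eta : ℝ) : ℝ := (2 + eta⁻¹ + eta) / 4

/-- `H = (η⁻¹ - η)/4`. -/
def etaMuH (eta : ℝ) : ℝ := (eta⁻¹ - eta) / 4

/-- Density of the `η`-`μ` distribution with mean `w`. The usual expression contains
`H^{-(μ-1/2)} I_{μ-1/2}(2μHx/w)`, which is an even entire function of `H`; it is written here as
`(μx/w)^{μ-1/2}` times the entire part of the Bessel function, so that it is also meaningful for
`H = 0` (`η = 1`) and `H < 0` (`η > 1`). See `etaMuPDF_eq` for the usual form. -/
def etaMuPDF (eta mu w x : ℝ) : ℝ :=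
  if 0 < x then
    2 * Real.sqrt Real.pi * mu ^ (mu + 1 / 2) * etaMuh eta ^ mu /
        (Real.Gamma mu * w ^ (mu + 1 / 2)) *
      x ^ (mu - 1 / 2) * Real.exp (-(2 * mu * etaMuh eta * x / w)) *
      ((mu * x / w) ^ (mu - 1 / 2) * besselISeries (mu - 1 / 2) (2 * mu * etaMuH eta * x / w))
  else 0

theorem etaMuPDF_eq (eta mu w x : ℝ) (hH : 0 < etaMuH eta) (hmu : 0 < mu) (hw : 0 < w)
    (hx : 0 < x) :
    etaMuPDF eta mu w x =
      2 * Real.sqrt Real.pi * mu ^ (mu + 1 / 2) * etaMuh eta ^ mu /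
          (Real.Gamma mu * etaMuH eta ^ (mu - 1 / 2) * w ^ (mu + 1 / 2)) *
        x ^ (mu - 1 / 2) * Real.exp (-(2 * mu * etaMuh eta * x / w)) *
        besselI (mu - 1 / 2) (2 * mu * etaMuH eta * x / w) := by
  have e : 2 * mu * etaMuH eta * x / w / 2 = etaMuH eta * (mu * x / w) := by ring
  have hp : etaMuH eta ^ (mu - 1 / 2) ≠ 0 := (Real.rpow_pos_of_pos hH _).ne'
  have hG : Real.Gamma mu ≠ 0 := (Real.Gamma_pos_of_pos hmu).ne'
  have hwp : w ^ (mu + 1 / 2) ≠ 0 := (Real.rpow_pos_of_pos hw _).ne'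
  rw [etaMuPDF, if_pos hx, besselI, e, Real.mul_rpow hH.le (by positivity)]
  field_simp

/-- The law of an `η`-`μ` fading power coefficient. -/
def etaMuLaw (eta mu w : ℝ) : Measure ℝ :=
  volume.withDensity fun x => ENNReal.ofReal (etaMuPDF eta mu w x)

/-! ### The cellular uplink model -/

/-- The Euclidean plane. -/
abbrev Plane : Type := EuclideanSpace ℝ (Fin 2)

/-- Number of points of the point process `{X_j}` in `B`. -/
def pointCount {Ω : Type*} (X : ℕ → Ω → Plane) (B : Set Plane) (ω : Ω) : ℕ∞ :=
  {j : ℕ | X j ω ∈ B}.encard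

/-- On the region `D`, the point process `{X_j}` is a homogeneous Poisson point process of
intensity `lam`. Points of the sequence outside `D` are not constrained. -/
structure IsHomogeneousPPPOn {Ω : Type*} [MeasurableSpace Ω] (P : Measure Ω)
    (X : ℕ → Ω → Plane) (D : Set Plane) (lam : ℝ) : Prop where
  measurable : ∀ j, Measurable (X j)
  poisson : ∀ B : Set Plane, B ⊆ D → MeasurableSet B → volume B ≠ ⊤ → ∀ k : ℕ,
    P {ω | pointCount X B ω = k} =
      ENNReal.ofReal (Real.exp (-(lam * (volume B).toReal)) *
        (lam * (volume B).toReal) ^ k / (Nat.factorial k : ℝ))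
  indep : ∀ (N : ℕ) (B : Fin N → Set Plane), (∀ i, B i ⊆ D) → (∀ i, MeasurableSet (B i)) →
    Pairwise (fun i i' => Disjoint (B i) (B i')) →
    iIndepFun (fun i ω => pointCount X (B i) ω) P

/-- Radius `R = (π λ_b)^{-1/2}` of a cell. -/
def cellRadius (lamb : ℝ) : ℝ := Real.sqrt (1 / (Real.pi * lamb))

/-- The cell `𝒜 = B(0, R)`. -/
def cell (lamb : ℝ) : Set Plane := Metric.ball 0 (cellRadius lamb)

/-- Law of the length of a cellular link: density `2πλ_b x` on `[0, R]`. -/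
def cellularLinkLaw (lamb : ℝ) : Measure ℝ :=
  volume.withDensity
    ((Set.Icc 0 (cellRadius lamb)).indicator fun x => ENNReal.ofReal (2 * Real.pi * lamb * x))

/-- The interferers of a cellular uplink: outside the cell the positions `X_j` form a PPP of
intensity `λ_b`; the points carry independent marks `(L_j, G_j)` (independent of the positions,
i.i.d. over `j`), with link length `L_j` and fading coefficient `G_j` independent of each other,
`L_j` having the cellular link law and `G_j` the law `fading`. -/
structure IsUplinkModel {Ω : Type*} [MeasurableSpace Ω] (P : Measure Ω)
    (X : ℕ → Ω → Plane) (L G : ℕ → Ω → ℝ) (lamb : ℝ) (fading : Measure ℝ) : Prop where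
  ppp : IsHomogeneousPPPOn P X (cell lamb)ᶜ lamb
  measurable_link : ∀ j, Measurable (L j)
  measurable_fading : ∀ j, Measurable (G j)
  link_law : ∀ j, P.map (L j) = cellularLinkLaw lamb
  fading_law : ∀ j, P.map (G j) = fading
  link_indep_fading : ∀ j, IndepFun (L j) (G j) P
  marks_indep : iIndepFun (fun j ω => (L j ω, G j ω)) P
  marks_indep_points : IndepFun (fun ω j => X j ω) (fun ω j => (L j ω, G j ω)) P

/-- Contribution of the `j`-th point to the interference: `P_j G_j ‖X_j‖^{-τ}`, with transmit power
`P_j = L_j^τ` (channel inversion), if `X_j` is outside the cell, and `0` otherwise. -/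
def interferenceTerm {Ω : Type*} (X : ℕ → Ω → Plane) (L G : ℕ → Ω → ℝ) (lamb tau : ℝ)
    (j : ℕ) (ω : Ω) : ℝ :=
  (cell lamb)ᶜ.indicator (fun x => L j ω ^ tau * G j ω * ‖x‖ ^ (-tau)) (X j ω)

/-- The interference `I_c` at the base station located at the origin. -/
def interference {Ω : Type*} (X : ℕ → Ω → Plane) (L G : ℕ → Ω → ℝ) (lamb tau : ℝ) (ω : Ω) : ℝ :=
  ∑' j, interferenceTerm X L G lamb tau j ω

/-- Laplace transform `E[exp(-sY)]` of a random variable. -/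
def laplaceTransform {Ω : Type*} [MeasurableSpace Ω] (P : Measure Ω) (Y : Ω → ℝ) (s : ℝ) : ℝ :=
  ∫ ω, Real.exp (-(s * Y ω)) ∂P

/-! ### The function `φ` -/

/-- Upper parameters `1-δ, 1` of the Meijer functions. -/
def upperParams (delta : ℝ) : Fin 2 → ℂ := ![((1 - delta : ℝ) : ℂ), 1]

/-- Lower parameters `0, β-δ` of the Meijer functions. -/
def lowerParams (delta beta : ℝ) : Fin 2 → ℂ := ![0, ((beta - delta : ℝ) : ℂ)]

/-- Argument `μ(1+κ)(πλ_b)^{1/δ} r^τ / (s w)`, `δ = 2/τ`. -/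
def kappaMuArg (kappa mu w lamb tau s r : ℝ) : ℝ :=
  mu * (1 + kappa) * (Real.pi * lamb) ^ (1 / (2 / tau)) * r ^ tau / (s * w)

/-- `n`-th term of the series in `φ` for `κ`-`μ` fading. -/
def kappaMuTerm (kappa mu w lamb tau s r : ℝ) (n : ℕ) : ℂ :=
  (((mu * kappa) ^ n / ((Nat.factorial n : ℝ) * Real.Gamma (mu + n)) : ℝ) : ℂ) *
    meijerG 2 1 (upperParams (2 / tau)) (lowerParams (2 / tau) (n + mu))
      (kappaMuArg kappa mu w lamb tau s r : ℂ)

/-- `φ` for `κ`-`μ` fading. -/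
def phiKappaMu (kappa mu w lamb tau s r : ℝ) : ℂ :=
  ((Real.pi * lamb * r ^ 2 * (2 / tau) / Real.exp (mu * kappa) *
      (mu * (1 + kappa) / (s * w)) ^ (2 / tau) : ℝ) : ℂ) *
    ∑' n : ℕ, kappaMuTerm kappa mu w lamb tau s r n

/-- Argument `2μh(πλ_b)^{1/δ} r^τ / (s w)`, `δ = 2/τ`. -/
def etaMuArg (eta mu w lamb tau s r : ℝ) : ℝ :=
  2 * mu * etaMuh eta * (Real.pi * lamb) ^ (1 / (2 / tau)) * r ^ tau / (s * w)

/-- `n`-th term of the series in `φ` for `η`-`μ` fading. -/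
def etaMuTerm (eta mu w lamb tau s r : ℝ) (n : ℕ) : ℂ :=
  (((2 : ℝ) ^ (-2 * (n : ℝ) - 2 * mu) / ((Nat.factorial n : ℝ) * Real.Gamma (mu + n + 1 / 2)) *
      (etaMuH eta / etaMuh eta) ^ (2 * n) : ℝ) : ℂ) *
    meijerG 2 1 (upperParams (2 / tau)) (lowerParams (2 / tau) (2 * n + 2 * mu))
      (etaMuArg eta mu w lamb tau s r : ℂ)

/-- `φ` for `η`-`μ` fading. -/
def phiEtaMu (eta mu w lamb tau s r : ℝ) : ℂ :=
  ((2 * Real.pi ^ (3 / 2 : ℝ) * lamb * r ^ 2 * (2 / tau) /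
      (Real.Gamma mu * etaMuh eta ^ mu) *
      (2 * mu * etaMuh eta / (s * w)) ^ (2 / tau) : ℝ) : ℂ) *
    ∑' n : ℕ, etaMuTerm eta mu w lamb tau s r n

end

/-! Both fading laws are mixtures of gamma laws with one common rate θ. Expanding the Bessel
function in its power series turns each term of the density into a gamma density: Poisson weights
and shapes n+μ for κ-μ fading, negative binomial weights and shapes 2n+2μ for η-μ fading, the latter
through Legendre's duplication formula. `IsGammaMixture` records this together with a finite mean,
and the probabilistic part uses nothing else about the fading.

Let M(r) = E exp(-s L^τ G r^{-τ}), the `markTransform`. Given L = l, a gamma component of shape b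
contributes (1 + a l^τ)^{-b} with a = s r^{-τ}/θ. Integrating over l and substituting t = a l^τ
gives, up to a factor, the incomplete beta integral of t^{δ-1}(1+t)^{-b} over (0, x]. The Meijer
function at z is Γ(b) times the same integral with x = 1/z. Indeed t^{δ-1}(1+t)^{-b} has Mellin
transform Γ(δ+u)Γ(b-δ-u)/Γ(b) at u+1, passing to the primitive multiplies it by -1/u = Γ(-u)/Γ(1-u),
and Mellin inversion recovers the primitive from the Mellin–Barnes integral (`meijerGLine_eq`).
Comparing the two series gives φ(r) = M(r) for r ≥ R.

For the point process, averaging over the i.i.d. marks replaces exp(-s I_c) by the product of the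
M(‖X_j‖), that is by exp(-Σ f(X_j)) with f = -log M(‖·‖) off the cell and f = 0 on it. The Poisson
Laplace functional (`IsHomogeneousPPPOn.lintegral_expNeg_tsum`) evaluates its mean to exp(-λ ∫
(1-M(‖x‖)) dx) over the complement of the cell, and polar coordinates give the stated integral.

Finiteness rests on τ > 2. By Campbell's formula E I_c is λ E[L^τ G] times the integral of ‖x‖^{-τ}
off the cell, where L ≤ R and G has finite mean. The bound 1 - M(r) ≤ s E[L^τ G] r^{-τ} gives
integrability of (1-φ(r))r. -/

open MeasureTheory ProbabilityTheory
open scoped ENNReal Topology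

/-! ### Mellin transforms and decay of Gamma products -/

/-- If `g` has a Mellin transform at `u + 1` and `Re u < 0`, then the primitive of `g` vanishing at
`0` has Mellin transform `-(mellin g (u + 1)) / u` at `u`. -/
theorem hasMellin_primitive {g : ℝ → ℂ} (hgm : Measurable g) {u : ℂ} (hu : u.re < 0)
    (hg : MellinConvergent g (u + 1)) :
    HasMellin (fun x => ∫ t in Set.Ioc 0 x, g t) u (-(mellin g (u + 1)) / u) := by
  set ν : Measure ℝ := volume.restrict (Set.Ioi 0) with hν
  have hg' : Integrable (fun t : ℝ => (t : ℂ) ^ u * g t) ν := by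
    have h : IntegrableOn (fun t : ℝ => (t : ℂ) ^ u * g t) (Set.Ioi 0) := by
      simpa [MellinConvergent] using hg
    exact h
  -- Fubini on the region t < x: integrating `F` in t gives the Mellin integrand of the primitive,
  -- integrating in x gives -t^u g(t)/u. The x-integral over (t, ∞) converges because Re u < 0.
  let F : ℝ × ℝ → ℂ := fun p =>
    {q : ℝ × ℝ | q.2 < q.1}.indicator (fun q => (q.1 : ℂ) ^ (u - 1) * g q.2) p
  have hFm : Measurable F := by
    refine Measurable.indicator ?_ (measurableSet_lt measurable_snd measurable_fst)
    exact ((Complex.measurable_ofReal.comp measurable_fst).pow_const _).mul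
      (hgm.comp measurable_snd)
  have hre : (u - 1).re < -1 := by simp; linarith
  have hFt : ∀ t : ℝ, (fun x => F (x, t)) =
      (Set.Ioi t).indicator (fun x : ℝ => (x : ℂ) ^ (u - 1) * g t) := by
    intro t
    ext x
    simp only [F, Set.indicator, Set.mem_ofPred_eq, Set.mem_Ioi]
  have hFx : ∀ x : ℝ, (fun t => F (x, t)) =
      (Set.Iio x).indicator (fun t : ℝ => (x : ℂ) ^ (u - 1) * g t) := by
    intro x
    ext t
    simp only [F, Set.indicator, Set.mem_ofPred_eq, Set.mem_Iio]
  have hsub : ∀ t : ℝ, 0 < t → ν.restrict (Set.Ioi t) = volume.restrict (Set.Ioi t) := by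
    intro t ht
    rw [hν, Measure.restrict_restrict measurableSet_Ioi, Set.inter_eq_left.2]
    exact Set.Ioi_subset_Ioi ht.le
  have hpow : ∀ t : ℝ, 0 < t → IntegrableOn (fun x : ℝ => (x : ℂ) ^ (u - 1)) (Set.Ioi t) :=
    fun t ht => integrableOn_Ioi_cpow_of_lt hre ht
  have hnorm : ∀ t : ℝ, 0 < t → ∫ x, ‖F (x, t)‖ ∂ν = (-u.re)⁻¹ * ‖(t : ℂ) ^ u * g t‖ := by
    intro t ht
    have h1 : (fun x => ‖F (x, t)‖) =
        (Set.Ioi t).indicator (fun x : ℝ => ‖(x : ℂ) ^ (u - 1) * g t‖) := by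
      ext x
      rw [congrFun (hFt t) x, norm_indicator_eq_indicator_norm]
    rw [h1, integral_indicator measurableSet_Ioi, hsub t ht]
    have h2 : ∫ x in Set.Ioi t, ‖(x : ℂ) ^ (u - 1) * g t‖ =
        ∫ x in Set.Ioi t, x ^ (u.re - 1) * ‖g t‖ := by
      refine setIntegral_congr_fun measurableSet_Ioi fun x hx => ?_
      have hx0 : 0 < x := ht.trans hx
      simp [Complex.norm_cpow_eq_rpow_re_of_pos hx0]
    rw [h2, integral_mul_const, integral_Ioi_rpow_of_lt (by linarith) ht, norm_mul,
      Complex.norm_cpow_eq_rpow_re_of_pos ht]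
    have : u.re ≠ 0 := hu.ne
    simp only [sub_add_cancel]
    field_simp
  have hint : Integrable F (ν.prod ν) := by
    rw [integrable_prod_iff' hFm.aestronglyMeasurable]
    constructor
    · filter_upwards [ae_restrict_mem measurableSet_Ioi] with t ht
      rw [hFt t, integrable_indicator_iff measurableSet_Ioi, IntegrableOn, hsub t ht]
      exact (hpow t ht).mul_const _
    · refine (hg'.norm.const_mul (-u.re)⁻¹).congr ?_
      filter_upwards [ae_restrict_mem measurableSet_Ioi] with t ht
      exact (hnorm t ht).symm
  have hinner : ∀ x : ℝ, 0 < x →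
      ∫ t, F (x, t) ∂ν = (x : ℂ) ^ (u - 1) • ∫ t in Set.Ioc 0 x, g t := by
    intro x hx
    rw [hFx x, integral_indicator measurableSet_Iio, hν,
      Measure.restrict_restrict measurableSet_Iio, Set.inter_comm, Set.Ioi_inter_Iio,
      integral_const_mul, integral_Ioc_eq_integral_Ioo, smul_eq_mul]
  have hinner' : ∀ t : ℝ, 0 < t → ∫ x, F (x, t) ∂ν = -u⁻¹ * ((t : ℂ) ^ u * g t) := by
    intro t ht
    rw [hFt t, integral_indicator measurableSet_Ioi, hsub t ht, integral_mul_const,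
      integral_Ioi_cpow_of_lt hre ht]
    have : u ≠ 0 := by rintro rfl; simp at hu
    simp only [sub_add_cancel]
    field_simp
  constructor
  · refine (hint.integral_prod_left).congr ?_
    filter_upwards [ae_restrict_mem measurableSet_Ioi] with x hx
    exact hinner x hx
  · calc mellin (fun x => ∫ t in Set.Ioc 0 x, g t) u
        = ∫ x, ∫ t, F (x, t) ∂ν ∂ν :=
          setIntegral_congr_fun measurableSet_Ioi fun x hx => (hinner x hx).symm
      _ = ∫ t, ∫ x, F (x, t) ∂ν ∂ν := integral_integral_swap hint
      _ = ∫ t, -u⁻¹ * ((t : ℂ) ^ u * g t) ∂ν :=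
          setIntegral_congr_fun measurableSet_Ioi fun t ht => hinner' t ht
      _ = -(mellin g (u + 1)) / u := by
          rw [integral_const_mul]
          simp only [mellin, add_sub_cancel_right, smul_eq_mul]
          ring

/-- The Mellin transform of `(1 + t)⁻ᵇ`: the beta integral of the second kind. -/
theorem hasMellin_one_add_cpow {a b : ℂ} (ha : 0 < a.re) (hab : a.re < b.re) :
    HasMellin (fun t : ℝ => ((1 + t : ℝ) : ℂ) ^ (-b)) a
      (Complex.Gamma a * Complex.Gamma (b - a) / Complex.Gamma b) := by
  have hba : 0 < (b - a).re := by simpa using hab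
  -- This substitution carries (0, ∞) onto (0, 1) and reduces the claim to Euler's beta integral.
  let f : ℝ → ℝ := fun t => t / (1 + t)
  let f' : ℝ → ℝ := fun t => 1 / (1 + t) ^ 2
  have himg : f '' Set.Ioi 0 = Set.Ioo 0 1 := by
    ext x
    constructor
    · rintro ⟨t, ht, rfl⟩
      have ht : 0 < t := ht
      exact ⟨by positivity, by simp only [f]; rw [div_lt_one (by positivity)]; linarith⟩
    · rintro ⟨h0, h1⟩
      have h1' : 0 < 1 - x := by linarith
      refine ⟨x / (1 - x), by simp only [Set.mem_Ioi]; positivity, ?_⟩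
      simp only [f]
      field_simp
      ring
  have hderiv : ∀ t ∈ Set.Ioi (0 : ℝ), HasDerivWithinAt f (f' t) (Set.Ioi 0) t := by
    intro t ht
    have ht : 0 < t := ht
    have h := (hasDerivAt_id t).div ((hasDerivAt_id t).const_add 1) (by simp; positivity)
    refine (h.congr_deriv ?_).hasDerivWithinAt
    simp [f']
  have hinj : Set.InjOn f (Set.Ioi 0) := by
    intro x hx y hy h
    have hx : 0 < x := hx
    have hy : 0 < y := hy
    simp only [f] at h
    field_simp at h
    linarith
  let B : ℝ → ℂ := fun x => (x : ℂ) ^ (a - 1) * (1 - (x : ℂ)) ^ (b - a - 1)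
  have hB : ∀ t ∈ Set.Ioi (0 : ℝ),
      |f' t| • B (f t) = (t : ℂ) ^ (a - 1) • ((1 + t : ℝ) : ℂ) ^ (-b) := by
    intro t ht
    have ht : 0 < t := ht
    have h1t : 0 < 1 + t := by linarith
    have hne : ((1 + t : ℝ) : ℂ) ≠ 0 := by exact_mod_cast h1t.ne'
    have e1 : (1 : ℂ) - ((f t : ℝ) : ℂ) = (((1 + t)⁻¹ : ℝ) : ℂ) := by
      rw [← Complex.ofReal_one, ← Complex.ofReal_sub]
      congr 1
      simp only [f]
      field_simp
      ring
    have e2 : ((f t : ℝ) : ℂ) = (t : ℂ) * (((1 + t)⁻¹ : ℝ) : ℂ) := by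
      simp only [f]
      push_cast
      rfl
    have e3 : (((|f' t| : ℝ)) : ℂ) = ((1 + t : ℝ) : ℂ) ^ (-2 : ℂ) := by
      rw [abs_of_pos (by simp only [f']; positivity), Complex.cpow_neg]
      norm_cast
      simp [f']
    have e4 : ∀ c : ℂ, ((((1 + t)⁻¹ : ℝ)) : ℂ) ^ c = ((1 + t : ℝ) : ℂ) ^ (-c) := by
      intro c
      rw [Complex.cpow_neg, Complex.ofReal_inv, Complex.inv_cpow]
      rw [Complex.arg_ofReal_of_nonneg h1t.le]
      exact Real.pi_pos.ne
    rw [Complex.real_smul, e3]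
    simp only [B]
    rw [e1, e2, Complex.mul_cpow_ofReal_nonneg ht.le (by positivity), e4, e4, smul_eq_mul,
      mul_assoc, mul_left_comm, ← Complex.cpow_add _ _ hne, ← Complex.cpow_add _ _ hne]
    congr 2
    ring
  have hconv : IntegrableOn B (Set.Ioo 0 1) := by
    have := Complex.betaIntegral_convergent ha hba
    rwa [intervalIntegrable_iff_integrableOn_Ioo_of_le zero_le_one] at this
  constructor
  · rw [← himg, integrableOn_image_iff_integrableOn_abs_deriv_smul measurableSet_Ioi hderiv hinj]
      at hconv
    exact hconv.congr_fun hB measurableSet_Ioi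
  · have hG : Complex.Gamma b ≠ 0 := Complex.Gamma_ne_zero_of_re_pos (by linarith)
    rw [Complex.Gamma_mul_Gamma_eq_betaIntegral ha hba, add_sub_cancel, mul_div_cancel_left₀ _ hG]
    have := integral_image_eq_integral_abs_deriv_smul measurableSet_Ioi hderiv hinj B
    rw [Complex.betaIntegral, intervalIntegral.integral_of_le zero_le_one,
      integral_Ioc_eq_integral_Ioo, ← himg]
    exact (this.trans (setIntegral_congr_fun measurableSet_Ioi hB)).symm

/-- `|Γ(z)| ≤ Γ(Re z)` in the right half plane. -/
theorem Complex.norm_Gamma_le_Gamma_re {z : ℂ} (hz : 0 < z.re) :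
    ‖Complex.Gamma z‖ ≤ Real.Gamma z.re := by
  rw [Complex.Gamma_eq_integral hz, Real.Gamma_eq_integral hz, Complex.GammaIntegral]
  refine (norm_integral_le_integral_norm _).trans_eq ?_
  refine setIntegral_congr_fun measurableSet_Ioi fun x hx => ?_
  have hx : 0 < x := hx
  simp [Complex.norm_cpow_eq_rpow_re_of_pos hx, Complex.norm_exp]

/-- A product of Gamma functions on a vertical line is integrable. -/
theorem integrable_Gamma_mul_Gamma {a b : ℝ} (ha : 0 < a) (hb : 0 < b) :
    Integrable fun t : ℝ =>
      Complex.Gamma (a + t * Complex.I) * Complex.Gamma (b - t * Complex.I) := by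
  have hre1 : ∀ t : ℝ, ((a : ℂ) + t * Complex.I).re = a := by intro t; simp
  have hre2 : ∀ t : ℝ, ((b : ℂ) - t * Complex.I).re = b := by intro t; simp
  have hcont : Continuous fun t : ℝ =>
      Complex.Gamma (a + t * Complex.I) * Complex.Gamma (b - t * Complex.I) := by
    refine continuous_iff_continuousAt.2 fun t => ContinuousAt.mul ?_ ?_
    · refine ContinuousAt.comp (g := Complex.Gamma)
        (f := fun t : ℝ => (a : ℂ) + t * Complex.I) ?_ (by fun_prop)
      refine (Complex.differentiableAt_Gamma _ fun m h => ?_).continuousAt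
      have := congrArg Complex.re h
      rw [hre1] at this
      simp at this
      have : (0 : ℝ) ≤ m := m.cast_nonneg
      linarith
    · refine ContinuousAt.comp (g := Complex.Gamma)
        (f := fun t : ℝ => (b : ℂ) - t * Complex.I) ?_ (by fun_prop)
      refine (Complex.differentiableAt_Gamma _ fun m h => ?_).continuousAt
      have := congrArg Complex.re h
      rw [hre2] at this
      simp at this
      have : (0 : ℝ) ≤ m := m.cast_nonneg
      linarith
  -- With k ≤ 1 and k at most the real part c, c² + t² ≥ k²(1 + t²); one constant then serves both
  -- Gamma factors.
  set k : ℝ := min 1 (min a b) with hk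
  have hk0 : 0 < k := by simp [hk, ha, hb]
  have hlow : ∀ (c t : ℝ) (z : ℂ), k ≤ c → z.re = c → |z.im| = |t| →
      k * Real.sqrt (1 + t ^ 2) ≤ ‖z‖ := by
    intro c t z hc hz1 hz2
    rw [Complex.norm_eq_sqrt_sq_add_sq, hz1, ← sq_abs z.im, hz2, sq_abs]
    refine Real.le_sqrt_of_sq_le ?_
    rw [mul_pow, Real.sq_sqrt (by positivity)]
    have h1 : k ≤ 1 := min_le_left _ _
    nlinarith [sq_nonneg t, mul_le_mul hc hc hk0.le (hk0.le.trans hc),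
      mul_le_mul h1 h1 hk0.le zero_le_one]
  refine Integrable.mono' ((integrable_inv_one_add_sq).const_mul
    (Real.Gamma (a + 1) * Real.Gamma (b + 1) * (k ^ 2)⁻¹)) hcont.aestronglyMeasurable ?_
  refine Filter.Eventually.of_forall fun t => ?_
  -- Γ(z) = Γ(z+1)/z together with |Γ(z+1)| ≤ Γ(Re z + 1) gains one power of |t|. Two such factors
  -- give the integrable majorant 1/(1+t²), so Stirling's formula is not needed.
  have key : ∀ z : ℂ, 0 < z.re → k ≤ z.re → |z.im| = |t| →
      ‖Complex.Gamma z‖ ≤ Real.Gamma (z.re + 1) / (k * Real.sqrt (1 + t ^ 2)) := by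
    intro z hz0 hz him
    have hzne : z ≠ 0 := by rintro rfl; simp at hz0
    have h := Complex.norm_Gamma_le_Gamma_re (z := z + 1) (by simp; linarith)
    rw [Complex.Gamma_add_one z hzne, norm_mul] at h
    rw [le_div_iff₀ (by positivity), mul_comm]
    refine le_trans (mul_le_mul_of_nonneg_right (hlow _ t z hz rfl him) (norm_nonneg _)) ?_
    simpa using h
  have h1 := key (a + t * Complex.I) (by rw [hre1]; exact ha)
    (by rw [hre1]; exact (min_le_right _ _).trans (min_le_left _ _)) (by simp)
  have h2 := key (b - t * Complex.I) (by rw [hre2]; exact hb)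
    (by rw [hre2]; exact (min_le_right _ _).trans (min_le_right _ _)) (by simp)
  rw [hre1] at h1
  rw [hre2] at h2
  rw [norm_mul]
  refine (mul_le_mul h1 h2 (norm_nonneg _) (by positivity)).trans_eq ?_
  rw [div_mul_div_comm]
  have : k * √(1 + t ^ 2) * (k * √(1 + t ^ 2)) = k ^ 2 * (1 + t ^ 2) := by
    rw [mul_mul_mul_comm, Real.mul_self_sqrt (by positivity)]; ring
  rw [this]
  field_simp

/-! ### Evaluation of the Meijer functions -/

/-- The incomplete beta integral which evaluates the Meijer functions. -/
noncomputable def incompleteBeta (d b x : ℝ) : ℝ :=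
  ∫ t in Set.Ioc 0 x, t ^ (d - 1) * (1 + t) ^ (-b)

theorem integrableOn_incompleteBeta {d : ℝ} (hd : 0 < d) {b : ℝ} (hb : 0 ≤ b) (x : ℝ) :
    IntegrableOn (fun t : ℝ => t ^ (d - 1) * (1 + t) ^ (-b)) (Set.Ioc 0 x) := by
  rcases le_or_gt x 0 with hx | hx
  · simp [Set.Ioc_eq_empty_of_le hx]
  have h := intervalIntegral.intervalIntegrable_rpow' (a := 0) (b := x)
    (show -1 < d - 1 by linarith)
  rw [intervalIntegrable_iff_integrableOn_Ioc_of_le hx.le] at h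
  refine Integrable.mono' h (by fun_prop) ?_
  filter_upwards [ae_restrict_mem measurableSet_Ioc] with t ht
  have ht0 : 0 < t := ht.1
  rw [Real.norm_of_nonneg (by positivity)]
  refine mul_le_of_le_one_right (by positivity) ?_
  exact Real.rpow_le_one_of_one_le_of_nonpos (by linarith) (by linarith)

/-- The parameters b₁ = 0 and a₂ = 1 contribute Γ(-u)/Γ(1-u), which collapses to -1/u: the
multiplier produced by taking a primitive. -/
theorem meijerGIntegrand_eq {d b : ℝ} {u : ℂ} (hu : u.re < 0) (z : ℂ) :
    meijerGIntegrand 2 1 (upperParams d) (lowerParams d b) z u =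
      z ^ u * (-(Complex.Gamma (d + u) * Complex.Gamma (b - (d + u))) / u) := by
  have hu0 : u ≠ 0 := by rintro rfl; simp at hu
  have hG : Complex.Gamma (-u) ≠ 0 := Complex.Gamma_ne_zero_of_re_pos (by simpa using hu)
  have h := Complex.Gamma_add_one (-u) (neg_ne_zero.2 hu0)
  rw [show -u + 1 = 1 - u by ring] at h
  simp only [meijerGIntegrand, upperParams, lowerParams, Fin.prod_univ_two]
  simp only [Matrix.cons_val_zero, Matrix.cons_val_one, Fin.val_zero, Fin.val_one]
  norm_num
  rw [h, show (b : ℂ) - d - u = b - (d + u) by ring]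
  field_simp

theorem meijerGSeparates_iff {d b c : ℝ} :
    MeijerGSeparates 2 1 (upperParams d) (lowerParams d b) c ↔ c < 0 ∧ c < b - d ∧ -d < c := by
  simp [MeijerGSeparates, upperParams, lowerParams, Fin.forall_fin_two, and_assoc]

/-- Evaluation of the Mellin–Barnes integral of `G^{2,1}_{2,2}(z | 1-d, 1; 0, b-d)`. -/
theorem meijerGLine_eq {d b z c : ℝ} (hd : 0 < d) (hb : 0 < b) (hz : 0 < z)
    (hc : MeijerGSeparates 2 1 (upperParams d) (lowerParams d b) c) :
    Integrable (fun t : ℝ => meijerGIntegrand 2 1 (upperParams d) (lowerParams d b) (z : ℂ)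
      ((c : ℂ) + (t : ℂ) * Complex.I)) ∧
    meijerGLine 2 1 (upperParams d) (lowerParams d b) (z : ℂ) c =
      ((Real.Gamma b * incompleteBeta d b z⁻¹ : ℝ) : ℂ) := by
  obtain ⟨hc0, hcb, hcd⟩ := meijerGSeparates_iff.1 hc
  have hzC : (z : ℂ) ≠ 0 := by exact_mod_cast hz.ne'
  have hGb : (Real.Gamma b : ℂ) ≠ 0 := by exact_mod_cast (Real.Gamma_pos_of_pos hb).ne'
  -- The factor t^{d-1} shifts the Mellin variable, so that the transform of `g` at u+1 is that of
  -- (1+t)^{-b} at d+u. The three inequalities on c are exactly Re u < 0 and 0 < Re(d+u) < b.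
  let g : ℝ → ℂ := fun t => (t : ℂ) ^ ((d : ℂ) - 1) • ((1 + t : ℝ) : ℂ) ^ (-(b : ℂ))
  have hgm : Measurable g := by
    exact (Complex.measurable_ofReal.pow_const _).smul
      ((Complex.measurable_ofReal.comp (measurable_const.add measurable_id)).pow_const _)
  let f : ℝ → ℂ := fun x => (Real.Gamma b : ℂ) • ∫ t in Set.Ioc 0 x, g t
  have hmel : ∀ u : ℂ, u.re = c →
      HasMellin f u (-(Complex.Gamma (d + u) * Complex.Gamma (b - (d + u))) / u) := by
    intro u hu
    have hG := hasMellin_one_add_cpow (a := d + u) (b := b) (by simp; linarith)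
      (by simp; linarith)
    have e : u + 1 + ((d : ℂ) - 1) = d + u := by ring
    have hgc : MellinConvergent g (u + 1) := by
      rw [MellinConvergent.cpow_smul, e]
      exact hG.1
    have hgv : mellin g (u + 1) = Complex.Gamma (d + u) * Complex.Gamma (b - (d + u)) /
        Complex.Gamma b := by
      rw [← hG.2, mellin_cpow_smul, e]
    have hp := hasMellin_primitive hgm (u := u) (by linarith) hgc
    have := hasMellin_const_smul hp.1 (Real.Gamma b : ℂ)
    rw [hp.2, hgv] at this
    convert this using 1
    rw [Complex.Gamma_ofReal, smul_eq_mul]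
    field_simp
  have hre : ∀ t : ℝ, ((c : ℂ) + t * Complex.I).re = c := by intro t; simp
  have hvert : Integrable fun t : ℝ =>
      -(Complex.Gamma (d + ((c : ℂ) + t * Complex.I)) *
        Complex.Gamma (b - (d + ((c : ℂ) + t * Complex.I)))) / ((c : ℂ) + t * Complex.I) := by
    have h0 := (integrable_Gamma_mul_Gamma (a := d + c) (b := b - (d + c)) (by linarith)
      (by linarith)).neg
    have hne : ∀ t : ℝ, (c : ℂ) + t * Complex.I ≠ 0 := by
      intro t h
      have := congrArg Complex.re h
      rw [hre] at this
      exact hc0.ne this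
    have hcont : Continuous fun t : ℝ => ((c : ℂ) + t * Complex.I)⁻¹ :=
      (by fun_prop : Continuous fun t : ℝ => (c : ℂ) + t * Complex.I).inv₀ hne
    refine (h0.mul_bdd (c := |c|⁻¹) hcont.aestronglyMeasurable
      (Filter.Eventually.of_forall fun t => ?_)).congr (Filter.Eventually.of_forall fun t => ?_)
    · rw [norm_inv]
      refine inv_anti₀ (abs_pos.2 hc0.ne) ?_
      simpa [hre] using Complex.abs_re_le_norm ((c : ℂ) + t * Complex.I)
    · simp only [Pi.neg_apply]
      push_cast
      rw [div_eq_mul_inv]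
      ring_nf
  -- Mellin inversion carries the kernel x^{-u}, the Meijer integral z^u; hence the inversion is
  -- performed at x = 1/z.
  have hI : ∀ t : ℝ, meijerGIntegrand 2 1 (upperParams d) (lowerParams d b) (z : ℂ)
      ((c : ℂ) + (t : ℂ) * Complex.I) = ((z⁻¹ : ℝ) : ℂ) ^ (-((c : ℂ) + t * Complex.I)) •
        mellin f ((c : ℂ) + t * Complex.I) := by
    intro t
    rw [meijerGIntegrand_eq (by rw [hre]; exact hc0), (hmel _ (hre t)).2, smul_eq_mul,
      Complex.ofReal_inv, Complex.inv_cpow, Complex.cpow_neg, inv_inv]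
    rw [Complex.arg_ofReal_of_nonneg hz.le]
    exact Real.pi_pos.ne
  have hfvert : Complex.VerticalIntegrable (mellin f) c :=
    hvert.congr (Filter.Eventually.of_forall fun t => ((hmel _ (hre t)).2).symm)
  have hgreal : ∀ t : ℝ, 0 < t → g t = ((t ^ (d - 1) * (1 + t) ^ (-b) : ℝ) : ℂ) := by
    intro t ht
    simp only [g, smul_eq_mul]
    rw [Complex.ofReal_mul, Complex.ofReal_cpow ht.le, Complex.ofReal_cpow (by linarith)]
    push_cast
    rfl
  have hgint : ∀ x : ℝ, IntegrableOn g (Set.Ioc 0 x) := by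
    intro x
    refine IntegrableOn.congr_fun (f := fun t : ℝ => ((t ^ (d - 1) * (1 + t) ^ (-b) : ℝ) : ℂ))
      ?_ (fun t ht => (hgreal t ht.1).symm) measurableSet_Ioc
    exact (integrableOn_incompleteBeta hd hb.le x).ofReal
  have hfval : f z⁻¹ = ((Real.Gamma b * incompleteBeta d b z⁻¹ : ℝ) : ℂ) := by
    simp only [f, smul_eq_mul, Complex.ofReal_mul, incompleteBeta]
    rw [← integral_complex_ofReal]
    congr 1
    exact setIntegral_congr_fun measurableSet_Ioc fun t ht => hgreal t ht.1
  -- Pointwise Mellin inversion needs continuity at the point; here it is continuity of a primitive.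
  have hfcont : ContinuousAt f z⁻¹ := by
    have hz' : 0 < z⁻¹ := inv_pos.2 hz
    have h := intervalIntegral.continuousOn_primitive (f := g) (a := 0) (b := z⁻¹ + 1)
      (μ := volume) ((hgint _).congr_set_ae Ioc_ae_eq_Icc.symm)
    exact ((h.continuousAt (Icc_mem_nhds hz' (by linarith))).const_smul (Real.Gamma b : ℂ))
  have hinv := mellinInv_mellin_eq c f (inv_pos.2 hz) (hmel c (by simp)).1 hfvert hfcont
  constructor
  · have hcont : Continuous fun t : ℝ => (z : ℂ) ^ ((c : ℂ) + t * Complex.I) :=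
      (by fun_prop : Continuous fun t : ℝ => (c : ℂ) + t * Complex.I).const_cpow (Or.inl hzC)
    refine (hvert.bdd_mul (c := z ^ c) hcont.aestronglyMeasurable
      (Filter.Eventually.of_forall fun t => ?_)).congr (Filter.Eventually.of_forall fun t => ?_)
    · rw [Complex.norm_cpow_eq_rpow_re_of_pos hz, hre]
    · exact (meijerGIntegrand_eq (by rw [hre]; exact hc0) _).symm
  · rw [← hfval, ← hinv, meijerGLine, mellinInv]
    simp_rw [hI]
    rw [Complex.real_smul]
    push_cast
    ring

theorem exists_meijerGSeparates {d b : ℝ} (hd : 0 < d) (hb : 0 < b) :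
    ∃ c, MeijerGSeparates 2 1 (upperParams d) (lowerParams d b) c := by
  obtain ⟨c, h1, h2⟩ := exists_between (show -d < min 0 (b - d) by simp [hd, hb])
  exact ⟨c, meijerGSeparates_iff.2 ⟨h2.trans_le (min_le_left _ _),
    h2.trans_le (min_le_right _ _), h1⟩⟩

theorem meijerG_eq {d b z : ℝ} (hd : 0 < d) (hb : 0 < b) (hz : 0 < z) :
    meijerG 2 1 (upperParams d) (lowerParams d b) (z : ℂ) =
      ((Real.Gamma b * incompleteBeta d b z⁻¹ : ℝ) : ℂ) := by
  have h := exists_meijerGSeparates hd hb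
  rw [meijerG, dif_pos h]
  exact (meijerGLine_eq hd hb hz h.choose_spec).2

/-- Every admissible line evaluates to the same incomplete beta integral, so independence of c
requires no contour shift. -/
theorem meijerGWellDefined {d b z : ℝ} (hd : 0 < d) (hb : 0 < b) (hz : 0 < z) :
    MeijerGWellDefined 2 1 (upperParams d) (lowerParams d b) (z : ℂ) := by
  refine ⟨exists_meijerGSeparates hd hb, fun c hc => ?_⟩
  have := meijerGLine_eq hd hb hz hc
  exact ⟨this.1, this.2.trans (meijerG_eq hd hb hz).symm⟩

/-! ### The exponential on [0, ∞] and Poisson sums -/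

/-- The function `x ↦ e⁻ˣ` on `[0, ∞]`. -/
noncomputable def ENNReal.expNeg (x : ℝ≥0∞) : ℝ≥0∞ := EReal.exp (-(x : EReal))

namespace ENNReal

theorem expNeg_zero : expNeg 0 = 1 := by simp [expNeg]

theorem expNeg_ofReal {x : ℝ} (hx : 0 ≤ x) :
    expNeg (ENNReal.ofReal x) = ENNReal.ofReal (Real.exp (-x)) := by
  rw [expNeg, EReal.coe_ennreal_ofReal, max_eq_left hx, ← EReal.coe_neg, EReal.exp_coe]

theorem expNeg_add (x y : ℝ≥0∞) : expNeg (x + y) = expNeg x * expNeg y := by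
  simp only [expNeg, EReal.exp_neg, EReal.coe_ennreal_add, EReal.exp_add]
  refine ENNReal.mul_inv (Or.inl ?_) (Or.inr ?_)
  · simp [EReal.exp_eq_zero_iff]
  · simp [EReal.exp_eq_zero_iff]

theorem continuous_expNeg : Continuous expNeg :=
  ENNReal.continuous_exp.comp (continuous_neg.comp continuous_coe_ennreal_ereal)

theorem measurable_expNeg : Measurable expNeg := continuous_expNeg.measurable

theorem antitone_expNeg : Antitone expNeg := fun _ _ h =>
  EReal.exp_monotone (EReal.neg_le_neg_iff.2 (by exact_mod_cast h))

theorem expNeg_le_one (x : ℝ≥0∞) : expNeg x ≤ 1 :=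
  (antitone_expNeg zero_le).trans_eq expNeg_zero

theorem expNeg_ne_top (x : ℝ≥0∞) : expNeg x ≠ ∞ :=
  ((expNeg_le_one x).trans_lt one_lt_top).ne

theorem expNeg_sum {ι : Type*} (s : Finset ι) (f : ι → ℝ≥0∞) :
    expNeg (∑ i ∈ s, f i) = ∏ i ∈ s, expNeg (f i) := by
  induction s using Finset.cons_induction with
  | empty => simp [expNeg_zero]
  | cons i s hi ih => rw [Finset.sum_cons, Finset.prod_cons, expNeg_add, ih]

theorem expNeg_mul_natCast (x : ℝ≥0∞) (k : ℕ) : expNeg (x * k) = expNeg x ^ k := by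
  have := expNeg_sum (Finset.range k) (fun _ => x)
  simpa [mul_comm] using this

/-- The generating function of the Poisson distribution. -/
theorem tsum_poisson_mul_expNeg_pow {m : ℝ} (hm : 0 ≤ m) (a : ℝ≥0∞) :
    ∑' k : ℕ, expNeg a ^ k * ENNReal.ofReal (Real.exp (-m) * m ^ k / (k.factorial : ℝ)) =
      expNeg (ENNReal.ofReal m * (1 - expNeg a)) := by
  set q : ℝ := (expNeg a).toReal with hq
  have hq0 : 0 ≤ q := toReal_nonneg
  have hqe : expNeg a = ENNReal.ofReal q := (ofReal_toReal (expNeg_ne_top a)).symm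
  have hq1 : q ≤ 1 := by
    have := expNeg_le_one a
    rw [hqe, ofReal_le_one] at this
    exact this
  have hterm : ∀ k : ℕ,
      expNeg a ^ k * ENNReal.ofReal (Real.exp (-m) * m ^ k / (k.factorial : ℝ)) =
        ENNReal.ofReal (Real.exp (-m) * ((m * q) ^ k / (k.factorial : ℝ))) := by
    intro k
    rw [hqe, ← ofReal_pow hq0, ← ofReal_mul (by positivity), mul_pow]
    congr 1
    ring
  have hs : HasSum (fun k : ℕ => (m * q) ^ k / (k.factorial : ℝ)) (Real.exp (m * q)) := by
    rw [Real.exp_eq_exp_ℝ]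
    exact NormedSpace.expSeries_div_hasSum_exp (m * q)
  rw [tsum_congr hterm, ← ofReal_tsum_of_nonneg (fun k => by positivity)
    (hs.summable.mul_left _), tsum_mul_left, hs.tsum_eq, ← Real.exp_add, hqe, ← ofReal_one,
    ← ofReal_sub _ hq0, ← ofReal_mul hm, expNeg_ofReal (mul_nonneg hm (by linarith))]
  congr 2
  ring

/-- The mean of the Poisson distribution. -/
theorem tsum_natCast_mul_poisson {m : ℝ} (hm : 0 ≤ m) :
    ∑' k : ℕ, (k : ℝ≥0∞) * ENNReal.ofReal (Real.exp (-m) * m ^ k / (k.factorial : ℝ)) =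
      ENNReal.ofReal m := by
  -- The term k = 0 vanishes and (k+1)/(k+1)! = 1/k!. The dummy factor `expNeg 0 ^ k` = 1 lets the
  -- generating function at a = 0 supply the remaining sum.
  have hterm : ∀ k : ℕ, ((k + 1 : ℕ) : ℝ≥0∞) *
      ENNReal.ofReal (Real.exp (-m) * m ^ (k + 1) / ((k + 1).factorial : ℝ)) =
        ENNReal.ofReal m * (expNeg 0 ^ k *
          ENNReal.ofReal (Real.exp (-m) * m ^ k / (k.factorial : ℝ))) := by
    intro k
    rw [expNeg_zero, one_pow, one_mul, ← ofReal_natCast, ← ofReal_mul (by positivity),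
      ← ofReal_mul hm, Nat.factorial_succ]
    congr 1
    push_cast
    field_simp
    ring
  rw [tsum_eq_zero_add' ENNReal.summable, tsum_congr hterm, ENNReal.tsum_mul_left,
    tsum_poisson_mul_expNeg_pow hm 0]
  simp [expNeg_zero]

/-- Monotone convergence for series. -/
theorem tendsto_tsum_of_monotone {ι : Type*} {f : ℕ → ι → ℝ≥0∞} {F : ι → ℝ≥0∞}
    (hf : ∀ i, Monotone fun n => f n i)
    (hlim : ∀ i, Filter.Tendsto (fun n => f n i) Filter.atTop (𝓝 (F i))) :
    Filter.Tendsto (fun n => ∑' i, f n i) Filter.atTop (𝓝 (∑' i, F i)) := by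
  let _ : MeasurableSpace ι := ⊤
  simp_rw [← lintegral_count]
  exact lintegral_tendsto_of_tendsto_of_monotone (fun n => measurable_from_top.aemeasurable)
    (Filter.Eventually.of_forall hf) (Filter.Eventually.of_forall hlim)

end ENNReal

open ENNReal

/-! ### Poisson processes: Laplace functional and Campbell's formula -/

theorem tsum_indicator_eq_pointCount {Ω : Type*} (X : ℕ → Ω → Plane) (B : Set Plane) (ω : Ω) :
    ∑' j, B.indicator (fun _ => (1 : ℝ≥0∞)) (X j ω) = (pointCount X B ω : ℝ≥0∞) := by
  rw [pointCount, ← ENNReal.tsum_set_one, tsum_subtype _ fun _ => (1 : ℝ≥0∞)]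
  rfl

section PointCount

variable {Ω : Type*} [MeasurableSpace Ω] {P : Measure Ω} {X : ℕ → Ω → Plane} {D : Set Plane}
  {lam : ℝ}

theorem measurable_pointCount (hX : ∀ j, Measurable (X j)) {B : Set Plane}
    (hB : MeasurableSet B) : Measurable (pointCount X B) := by
  have h : Measurable fun ω => (pointCount X B ω : ℝ≥0∞) := by
    simp_rw [← tsum_indicator_eq_pointCount]
    exact Measurable.tsum fun j => (measurable_const.indicator hB).comp (hX j)
  refine measurable_to_countable' fun k => ?_
  have : pointCount X B ⁻¹' {k} = (fun ω => (pointCount X B ω : ℝ≥0∞)) ⁻¹' {(k : ℝ≥0∞)} := by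
    ext ω
    simp
  rw [this]
  exact h (measurableSet_singleton _)

/-- Expectation of a function of the number of points of a Poisson process in a set. -/
theorem IsHomogeneousPPPOn.lintegral_pointCount [IsProbabilityMeasure P]
    (h : IsHomogeneousPPPOn P X D lam) (hlam : 0 ≤ lam) {B : Set Plane} (hBD : B ⊆ D)
    (hB : MeasurableSet B) (hBv : volume B ≠ ⊤) (F : ℕ∞ → ℝ≥0∞) :
    ∫⁻ ω, F (pointCount X B ω) ∂P =
      ∑' k : ℕ, F k * ENNReal.ofReal (Real.exp (-(lam * (volume B).toReal)) *
        (lam * (volume B).toReal) ^ k / (k.factorial : ℝ)) := by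
  have hm : 0 ≤ lam * (volume B).toReal := mul_nonneg hlam toReal_nonneg
  have hN := measurable_pointCount h.measurable hB
  have hset : ∀ k : ℕ, MeasurableSet {ω | pointCount X B ω = k} := fun k =>
    hN (measurableSet_singleton (k : ℕ∞))
  -- The hypothesis only prescribes probabilities of finite counts; as these sum to 1, an infinite
  -- count has probability zero.
  have hfin : ∀ᵐ ω ∂P, ∃ k : ℕ, pointCount X B ω = k := by
    have hdisj : Pairwise (Function.onFun Disjoint fun k : ℕ => {ω | pointCount X B ω = k}) := by
      intro k l hkl
      refine Set.disjoint_left.2 fun ω hk hl => hkl ?_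
      have hk : pointCount X B ω = k := hk
      have hl : pointCount X B ω = l := hl
      exact_mod_cast hk.symm.trans hl
    have hone : P (⋃ k : ℕ, {ω | pointCount X B ω = k}) = 1 := by
      rw [measure_iUnion hdisj hset, tsum_congr fun k => h.poisson B hBD hB hBv k]
      have := tsum_poisson_mul_expNeg_pow hm 0
      simpa [expNeg_zero] using this
    have := (mem_ae_iff_prob_eq_one (MeasurableSet.iUnion hset)).2 hone
    filter_upwards [this] with ω hω
    simpa using hω
  have hae : ∀ᵐ ω ∂P, F (pointCount X B ω) =
      ∑' k : ℕ, {ω | pointCount X B ω = k}.indicator (fun _ => F k) ω := by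
    filter_upwards [hfin] with ω ⟨k, hk⟩
    rw [tsum_eq_single k]
    · simp [hk]
    · intro l hl
      refine Set.indicator_of_notMem (fun h' => hl ?_) _
      have h' : pointCount X B ω = l := h'
      exact_mod_cast h'.symm.trans hk
  rw [lintegral_congr_ae hae, lintegral_tsum fun k =>
    (measurable_const.indicator (hset k)).aemeasurable]
  refine tsum_congr fun k => ?_
  rw [lintegral_indicator_const (hset k), h.poisson B hBD hB hBv k]

theorem IsHomogeneousPPPOn.lintegral_expNeg_mul_pointCount [IsProbabilityMeasure P]
    (h : IsHomogeneousPPPOn P X D lam) (hlam : 0 ≤ lam) {B : Set Plane} (hBD : B ⊆ D)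
    (hB : MeasurableSet B) (hBv : volume B ≠ ⊤) (a : ℝ≥0∞) :
    ∫⁻ ω, expNeg (a * (pointCount X B ω : ℝ≥0∞)) ∂P =
      expNeg (ENNReal.ofReal lam * ((1 - expNeg a) * volume B)) := by
  rw [h.lintegral_pointCount hlam hBD hB hBv fun k => expNeg (a * (k : ℝ≥0∞))]
  simp only [ENat.toENNReal_coe, expNeg_mul_natCast]
  rw [tsum_poisson_mul_expNeg_pow (mul_nonneg hlam toReal_nonneg), ofReal_mul hlam,
    ofReal_toReal hBv, mul_assoc, mul_comm (volume B)]

/-- The Laplace functional of a Poisson process, for simple functions. -/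
theorem IsHomogeneousPPPOn.lintegral_expNeg_tsum_simpleFunc [IsProbabilityMeasure P]
    (h : IsHomogeneousPPPOn P X D lam) (hlam : 0 ≤ lam) (g : SimpleFunc Plane ℝ≥0∞)
    (hgD : ∀ x, g x ≠ 0 → x ∈ D) (hgv : ∀ y, y ≠ 0 → volume (g ⁻¹' {y}) ≠ ⊤) :
    ∫⁻ ω, expNeg (∑' j, g (X j ω)) ∂P =
      expNeg (ENNReal.ofReal lam * ∫⁻ x, (1 - expNeg (g x))) := by
  classical
  -- The value 0 is dropped: its level set may leave D and have infinite volume, and it contributes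
  -- nothing to either side.
  set S : Finset ℝ≥0∞ := g.range.filter (· ≠ 0) with hS
  have hne : ∀ y ∈ S, y ≠ 0 := fun y hy => (Finset.mem_filter.1 hy).2
  have hsub : ∀ y ∈ S, g ⁻¹' {y} ⊆ D := by
    intro y hy x hx
    have hx : g x = y := hx
    exact hgD x (by rw [hx]; exact hne y hy)
  have hpt : ∀ x, g x = ∑ y ∈ S, y * (g ⁻¹' {y}).indicator (fun _ => (1 : ℝ≥0∞)) x := by
    intro x
    by_cases hx : g x = 0
    · rw [hx, Finset.sum_eq_zero]
      intro y hy
      rw [Set.indicator_of_notMem, mul_zero]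
      intro h'
      have h' : g x = y := h'
      exact hne y hy (h'.symm.trans hx)
    · rw [Finset.sum_eq_single (g x)]
      · simp
      · intro y _ hy
        rw [Set.indicator_of_notMem, mul_zero]
        exact fun h' => hy (Eq.symm h')
      · intro h'
        exact absurd (Finset.mem_filter.2 ⟨g.mem_range_self x, hx⟩) h'
  have hsum : ∀ ω, ∑' j, g (X j ω) = ∑ y ∈ S, y * (pointCount X (g ⁻¹' {y}) ω : ℝ≥0∞) := by
    intro ω
    simp_rw [fun j => hpt (X j ω)]
    rw [Summable.tsum_finsetSum fun _ _ => ENNReal.summable]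
    refine Finset.sum_congr rfl fun y _ => ?_
    rw [ENNReal.tsum_mul_left, tsum_indicator_eq_pointCount]
  let e : Fin S.card ≃ S := S.equivFin.symm
  have hprod : ∀ F : ℝ≥0∞ → ℝ≥0∞, ∏ y ∈ S, F y = ∏ i : Fin S.card, F (e i) := by
    intro F
    rw [← Finset.prod_coe_sort S F]
    exact (Equiv.prod_comp e fun y : S => F y).symm
  have hind := h.indep S.card (fun i => g ⁻¹' {(e i : ℝ≥0∞)}) (fun i => hsub _ (e i).2)
    (fun i => g.measurableSet_fiber _) (by
      intro i i' hii
      refine Set.disjoint_left.2 fun x hx hx' => hii ?_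
      have hx : g x = e i := hx
      have hx' : g x = e i' := hx'
      exact e.injective (Subtype.ext (hx.symm.trans hx')))
  have hind' := hind.comp (fun i k => expNeg ((e i : ℝ≥0∞) * (k : ℝ≥0∞)))
    (fun i => measurable_from_top)
  simp_rw [hsum, expNeg_sum, hprod]
  have hmeas : ∀ i : Fin S.card, Measurable ((fun k : ℕ∞ => expNeg ((e i : ℝ≥0∞) * (k : ℝ≥0∞))) ∘
      fun ω => pointCount X (g ⁻¹' {(e i : ℝ≥0∞)}) ω) := fun i =>
    measurable_from_top.comp (measurable_pointCount h.measurable (g.measurableSet_fiber _))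
  have key := lintegral_prod_eq_prod_lintegral_of_indepFun Finset.univ _ hind' hmeas
  simp only [Function.comp_def] at key
  rw [key]
  simp_rw [fun i : Fin S.card => h.lintegral_expNeg_mul_pointCount hlam (hsub _ (e i).2)
    (g.measurableSet_fiber _) (hgv _ (hne _ (e i).2)) (e i : ℝ≥0∞)]
  rw [← hprod fun y => expNeg (ENNReal.ofReal lam * ((1 - expNeg y) * volume (g ⁻¹' {y}))),
    ← expNeg_sum, ← Finset.mul_sum]
  congr 2
  have h1 : ∫⁻ x, (1 - expNeg (g x)) = (g.map fun y => 1 - expNeg y).lintegral volume := by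
    rw [← SimpleFunc.lintegral_eq_lintegral]
    rfl
  rw [h1, SimpleFunc.map_lintegral, hS, Finset.sum_filter]
  refine Finset.sum_congr rfl fun y _ => ?_
  split_ifs with hy
  · rfl
  · rw [not_not.1 hy]
    simp [expNeg_zero]

/-- The Laplace functional of a Poisson process. -/
theorem IsHomogeneousPPPOn.lintegral_expNeg_tsum [IsProbabilityMeasure P]
    (h : IsHomogeneousPPPOn P X D lam) (hlam : 0 ≤ lam) {f : Plane → ℝ≥0∞} (hf : Measurable f)
    (hfD : ∀ x, x ∉ D → f x = 0) :
    ∫⁻ ω, expNeg (∑' j, f (X j ω)) ∂P =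
      expNeg (ENNReal.ofReal lam * ∫⁻ x, (1 - expNeg (f x))) := by
  -- Cutting the simple approximants off to balls gives their nonzero level sets finite volume,
  -- while keeping the sequence monotone with limit f.
  let g : ℕ → SimpleFunc Plane ℝ≥0∞ := fun n =>
    (SimpleFunc.eapprox f n).restrict (Metric.ball 0 n)
  have hgval : ∀ n x, g n x = (Metric.ball (0 : Plane) n).indicator (SimpleFunc.eapprox f n) x :=
    fun n x => SimpleFunc.restrict_apply _ measurableSet_ball x
  have hgle : ∀ n x, g n x ≤ SimpleFunc.eapprox f n x := by
    intro n x
    rw [hgval]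
    exact Set.indicator_le_self _ _ x
  have hle : ∀ n x, SimpleFunc.eapprox f n x ≤ f x := by
    intro n x
    rw [← SimpleFunc.iSup_eapprox_apply hf x]
    exact le_iSup (fun n => SimpleFunc.eapprox f n x) n
  have hmono : ∀ x, Monotone fun n => g n x := by
    intro x m n hmn
    simp only [hgval]
    have hb : Metric.ball (0 : Plane) m ⊆ Metric.ball 0 n :=
      Metric.ball_subset_ball (by exact_mod_cast hmn)
    refine (Set.indicator_le_indicator (SimpleFunc.monotone_eapprox f hmn x)).trans ?_
    exact Set.indicator_le_indicator_of_subset hb (fun _ => zero_le) x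
  have hlim : ∀ x, Filter.Tendsto (fun n => g n x) Filter.atTop (𝓝 (f x)) := by
    intro x
    have h1 : Filter.Tendsto (fun n => SimpleFunc.eapprox f n x) Filter.atTop (𝓝 (f x)) := by
      rw [← SimpleFunc.iSup_eapprox_apply hf x]
      exact tendsto_atTop_iSup fun m n hmn => SimpleFunc.monotone_eapprox f hmn x
    refine h1.congr' ?_
    obtain ⟨N, hN⟩ := exists_nat_gt ‖x‖
    filter_upwards [Filter.eventually_ge_atTop N] with n hn
    rw [hgval, Set.indicator_of_mem]
    have : (N : ℝ) ≤ n := by exact_mod_cast hn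
    simpa using hN.trans_le this
  have hsimple : ∀ n, ∫⁻ ω, expNeg (∑' j, g n (X j ω)) ∂P =
      expNeg (ENNReal.ofReal lam * ∫⁻ x, (1 - expNeg (g n x))) := by
    intro n
    refine h.lintegral_expNeg_tsum_simpleFunc hlam (g n) ?_ ?_
    · intro x hx
      by_contra hxD
      have : g n x ≤ 0 := (hgle n x).trans ((hle n x).trans_eq (hfD x hxD))
      exact hx (le_antisymm this zero_le)
    · intro y hy
      have : g n ⁻¹' {y} ⊆ Metric.ball 0 n := by
        intro x hx
        have hx : g n x = y := hx
        by_contra hxb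
        rw [hgval, Set.indicator_of_notMem hxb] at hx
        exact hy hx.symm
      exact ((measure_mono this).trans_lt measure_ball_lt_top).ne
  have hL : Filter.Tendsto (fun n => ∫⁻ ω, expNeg (∑' j, g n (X j ω)) ∂P) Filter.atTop
      (𝓝 (∫⁻ ω, expNeg (∑' j, f (X j ω)) ∂P)) := by
    refine tendsto_lintegral_of_dominated_convergence (fun _ => 1) (fun n => ?_)
      (fun n => Filter.Eventually.of_forall fun ω => expNeg_le_one _) (by simp)
      (Filter.Eventually.of_forall fun ω => ?_)
    · exact measurable_expNeg.comp
        (Measurable.tsum fun j => (g n).measurable.comp (h.measurable j))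
    · exact (continuous_expNeg.tendsto _).comp
        (tendsto_tsum_of_monotone (fun j => hmono _) (fun j => hlim _))
  have hR : Filter.Tendsto (fun n => expNeg (ENNReal.ofReal lam * ∫⁻ x, (1 - expNeg (g n x))))
      Filter.atTop (𝓝 (expNeg (ENNReal.ofReal lam * ∫⁻ x, (1 - expNeg (f x))))) := by
    refine (continuous_expNeg.tendsto _).comp ?_
    refine ENNReal.Tendsto.const_mul ?_ (Or.inr ofReal_ne_top)
    refine lintegral_tendsto_of_tendsto_of_monotone (fun n => ?_)
      (Filter.Eventually.of_forall fun x => ?_) (Filter.Eventually.of_forall fun x => ?_)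
    · exact (measurable_const.sub (measurable_expNeg.comp (g n).measurable)).aemeasurable
    · exact fun m n hmn => tsub_le_tsub_left (antitone_expNeg (hmono x hmn)) 1
    · exact ENNReal.Tendsto.sub tendsto_const_nhds
        ((continuous_expNeg.tendsto _).comp (hlim x)) (Or.inl one_ne_top)
  exact tendsto_nhds_unique hL (by simpa only [hsimple] using hR)

/-- Campbell's formula for a Poisson process. -/
theorem IsHomogeneousPPPOn.tsum_lintegral [IsProbabilityMeasure P]
    (h : IsHomogeneousPPPOn P X D lam) (hlam : 0 ≤ lam) (hD : MeasurableSet D)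
    {f : Plane → ℝ≥0∞} (hf : Measurable f) (hfD : ∀ x, x ∉ D → f x = 0) :
    ∑' j, ∫⁻ ω, f (X j ω) ∂P = ENNReal.ofReal lam * ∫⁻ x, f x := by
  have hmean : ∀ B ⊆ D, MeasurableSet B → volume B ≠ ⊤ →
      ∑' j, P.map (X j) B = ENNReal.ofReal lam * volume B := by
    intro B hBD hB hBv
    have h1 := h.lintegral_pointCount hlam hBD hB hBv fun k => (k : ℝ≥0∞)
    simp only [ENat.toENNReal_coe] at h1
    rw [tsum_natCast_mul_poisson (mul_nonneg hlam toReal_nonneg), ofReal_mul hlam,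
      ofReal_toReal hBv] at h1
    rw [← h1]
    simp_rw [← tsum_indicator_eq_pointCount]
    have hm : ∀ j, Measurable fun ω => B.indicator (fun _ => (1 : ℝ≥0∞)) (X j ω) := fun j =>
      (measurable_const.indicator hB).comp (h.measurable j)
    rw [lintegral_tsum fun j => (hm j).aemeasurable]
    refine tsum_congr fun j => ?_
    rw [Measure.map_apply (h.measurable j) hB, ← lintegral_indicator_one (h.measurable j hB)]
    rfl
  -- The intensity measure is identified on bounded subsets of D, where the Poisson mean is
  -- available, and extended by continuity from below along balls.
  have hmeas : (Measure.sum fun j => P.map (X j)).restrict D =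
      (ENNReal.ofReal lam • volume).restrict D := by
    refine Measure.ext fun B hB => ?_
    have hmono : Monotone fun n : ℕ => B ∩ D ∩ Metric.ball 0 n := fun m n hmn =>
      Set.inter_subset_inter_right _ (Metric.ball_subset_ball (by exact_mod_cast hmn))
    have hU : B ∩ D = ⋃ n : ℕ, B ∩ D ∩ Metric.ball 0 n := by
      rw [← Set.inter_iUnion, Metric.iUnion_ball_nat, Set.inter_univ]
    rw [Measure.restrict_apply hB, Measure.restrict_apply hB, hU, hmono.measure_iUnion,
      hmono.measure_iUnion]
    refine iSup_congr fun n => ?_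
    have hBn : MeasurableSet (B ∩ D ∩ Metric.ball 0 n) := (hB.inter hD).inter measurableSet_ball
    rw [Measure.sum_apply _ hBn, hmean _ (fun x hx => hx.1.2) hBn, Measure.smul_apply, smul_eq_mul]
    exact ((measure_mono Set.inter_subset_right).trans_lt measure_ball_lt_top).ne
  have hsupp : ∀ ν : Measure Plane, ∫⁻ x, f x ∂(ν.restrict D) = ∫⁻ x, f x ∂ν := by
    intro ν
    rw [← lintegral_indicator hD]
    refine lintegral_congr fun x => ?_
    by_cases hx : x ∈ D
    · rw [Set.indicator_of_mem hx]
    · rw [Set.indicator_of_notMem hx, hfD x hx]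
  have := congrArg (fun ν => ∫⁻ x, f x ∂ν) hmeas
  simp only [hsupp, lintegral_sum_measure, lintegral_smul_measure, smul_eq_mul] at this
  rw [← this]
  exact tsum_congr fun j => (lintegral_map hf (h.measurable j)).symm

end PointCount

/-! ### Gamma laws and their mixtures -/

/-- `law` is the mixture of the gamma distributions of shapes `β n` and rate `θ` with weights
`c n`, and has a finite mean. -/
structure IsGammaMixture (law : Measure ℝ) (c β : ℕ → ℝ) (θ : ℝ) : Prop where
  rate_pos : 0 < θ
  weight_nonneg : ∀ n, 0 ≤ c n
  shape_pos : ∀ n, 0 < β n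
  law_eq : law = Measure.sum fun n => ENNReal.ofReal (c n) • gammaMeasure (β n) θ
  summable_mean : Summable fun n => c n * β n

theorem measurable_gammaPDF (a r : ℝ) : Measurable (gammaPDF a r) :=
  (measurable_gammaPDFReal a r).ennreal_ofReal

theorem lintegral_gammaMeasure (a r : ℝ) {F : ℝ → ℝ≥0∞} (hF : Measurable F) :
    ∫⁻ x, F x ∂(gammaMeasure a r) = ∫⁻ x, gammaPDF a r x * F x := by
  rw [gammaMeasure, lintegral_withDensity_eq_lintegral_mul _ (measurable_gammaPDF a r) hF]
  rfl

/-- The Laplace transform of a gamma distribution. -/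
theorem lintegral_exp_gammaMeasure {a r q : ℝ} (ha : 0 < a) (hr : 0 < r) (hq : 0 ≤ q) :
    ∫⁻ x, ENNReal.ofReal (Real.exp (-(q * x))) ∂(gammaMeasure a r) =
      ENNReal.ofReal ((1 + q / r) ^ (-a)) := by
  have hrq : 0 < r + q := by linarith
  rw [lintegral_gammaMeasure _ _ (by fun_prop)]
  -- Exponential tilting changes the rate from r to r + q, so the integral is the normalising ratio.
  have h : ∀ x, gammaPDF a r x * ENNReal.ofReal (Real.exp (-(q * x))) =
      ENNReal.ofReal ((1 + q / r) ^ (-a)) * gammaPDF a (r + q) x := by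
    intro x
    rw [gammaPDF, gammaPDF, ← ofReal_mul (gammaPDFReal_nonneg ha hr x),
      ← ofReal_mul (by positivity)]
    congr 1
    unfold gammaPDFReal
    split_ifs with hx
    · have e1 : (1 + q / r) ^ (-a) * (r + q) ^ a = r ^ a := by
        rw [show 1 + q / r = (r + q) / r by field_simp, Real.rpow_neg (by positivity),
          Real.div_rpow hrq.le hr.le]
        have := (Real.rpow_pos_of_pos hrq a).ne'
        field_simp
      have e2 : Real.exp (-((r + q) * x)) = Real.exp (-(r * x)) * Real.exp (-(q * x)) := by
        rw [← Real.exp_add]; ring_nf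
      rw [e2, ← e1]
      ring
    · simp
  simp_rw [h]
  rw [lintegral_const_mul _ (measurable_gammaPDF _ _), lintegral_gammaPDF_eq_one ha hrq, mul_one]

/-- The mean of a gamma distribution. -/
theorem lintegral_id_gammaMeasure {a r : ℝ} (ha : 0 < a) (hr : 0 < r) :
    ∫⁻ x, ENNReal.ofReal x ∂(gammaMeasure a r) = ENNReal.ofReal (a / r) := by
  rw [lintegral_gammaMeasure _ _ (by fun_prop)]
  -- Size-biasing raises the shape from a to a + 1; the ratio of normalisations is the mean a/r.
  have h : ∀ x, gammaPDF a r x * ENNReal.ofReal x =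
      ENNReal.ofReal (a / r) * gammaPDF (a + 1) r x := by
    intro x
    rw [gammaPDF, gammaPDF, ← ofReal_mul (gammaPDFReal_nonneg ha hr x),
      ← ofReal_mul (by positivity)]
    congr 1
    unfold gammaPDFReal
    split_ifs with hx
    · have hG : Real.Gamma a ≠ 0 := (Real.Gamma_pos_of_pos ha).ne'
      rw [Real.Gamma_add_one ha.ne', Real.rpow_add_one hr.ne', add_sub_cancel_right]
      rcases hx.eq_or_lt with rfl | hx
      · simp [Real.zero_rpow ha.ne']
      · rw [Real.rpow_sub_one hx.ne']
        field_simp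
    · simp
  simp_rw [h]
  rw [lintegral_const_mul _ (measurable_gammaPDF _ _),
    lintegral_gammaPDF_eq_one (by linarith) hr, mul_one]

theorem gammaMeasure_Iio_zero (a r : ℝ) : gammaMeasure a r (Set.Iio 0) = 0 := by
  rw [gammaMeasure, withDensity_apply _ measurableSet_Iio]
  exact lintegral_gammaPDF_of_nonpos le_rfl

namespace IsGammaMixture

variable {law : Measure ℝ} {c β : ℕ → ℝ} {θ : ℝ}

theorem lintegral_eq (h : IsGammaMixture law c β θ) (F : ℝ → ℝ≥0∞) :
    ∫⁻ x, F x ∂law = ∑' n, ENNReal.ofReal (c n) * ∫⁻ x, F x ∂(gammaMeasure (β n) θ) := by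
  rw [h.law_eq, lintegral_sum_measure]
  simp

/-- The Laplace transform of a mixture of gamma distributions. -/
theorem lintegral_exp (h : IsGammaMixture law c β θ) {q : ℝ} (hq : 0 ≤ q) :
    ∫⁻ x, ENNReal.ofReal (Real.exp (-(q * x))) ∂law =
      ∑' n, ENNReal.ofReal (c n * (1 + q / θ) ^ (-(β n))) := by
  rw [h.lintegral_eq]
  refine tsum_congr fun n => ?_
  rw [lintegral_exp_gammaMeasure (h.shape_pos n) h.rate_pos hq, ofReal_mul (h.weight_nonneg n)]

theorem lintegral_id_ne_top (h : IsGammaMixture law c β θ) :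
    ∫⁻ x, ENNReal.ofReal x ∂law ≠ ⊤ := by
  rw [h.lintegral_eq]
  have : ∀ n, ENNReal.ofReal (c n) * ∫⁻ x, ENNReal.ofReal x ∂(gammaMeasure (β n) θ) =
      ENNReal.ofReal (c n * β n / θ) := by
    intro n
    rw [lintegral_id_gammaMeasure (h.shape_pos n) h.rate_pos, ← ofReal_mul (h.weight_nonneg n),
      mul_div_assoc]
  rw [tsum_congr this]
  exact (h.summable_mean.div_const θ).tsum_ofReal_ne_top

theorem ae_nonneg (h : IsGammaMixture law c β θ) : ∀ᵐ x ∂law, 0 ≤ x := by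
  have : law (Set.Iio 0) = 0 := by
    rw [h.law_eq, Measure.sum_apply _ measurableSet_Iio]
    simp [gammaMeasure_Iio_zero]
  filter_upwards [measure_eq_zero_iff_ae_notMem.1 this] with x hx
  simpa using hx

/-- A density that is a series of gamma densities defines a mixture. -/
theorem withDensity_eq_sum {pdf : ℝ → ℝ} (hθ : 0 < θ) (hc : ∀ n, 0 ≤ c n) (hβ : ∀ n, 0 < β n)
    (h0 : ∀ x < 0, pdf x = 0)
    (h : ∀ x, 0 < x → HasSum (fun n => c n * gammaPDFReal (β n) θ x) (pdf x)) :
    volume.withDensity (fun x => ENNReal.ofReal (pdf x)) =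
      Measure.sum fun n => ENNReal.ofReal (c n) • gammaMeasure (β n) θ := by
  have hae : (fun x => ENNReal.ofReal (pdf x)) =ᵐ[volume]
      ∑' n, (ENNReal.ofReal (c n) • gammaPDF (β n) θ) := by
    have hne : ∀ᵐ x : ℝ, x ≠ 0 := by simp [ae_iff]
    filter_upwards [hne] with x hx
    rw [tsum_apply (Pi.summable.2 fun _ => ENNReal.summable)]
    rcases lt_or_gt_of_ne hx with hx | hx
    · simp [h0 x hx, gammaPDF_of_neg hx]
    · have hnn : ∀ n, 0 ≤ c n * gammaPDFReal (β n) θ x := fun n =>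
        mul_nonneg (hc n) (gammaPDFReal_nonneg (hβ n) hθ x)
      rw [← (h x hx).tsum_eq, ofReal_tsum_of_nonneg hnn (h x hx).summable]
      refine tsum_congr fun n => ?_
      rw [ofReal_mul (hc n)]
      rfl
  rw [withDensity_congr_ae hae, withDensity_tsum fun n => (measurable_gammaPDF _ _).const_smul _]
  congr 1
  ext1 n
  rw [withDensity_smul _ (measurable_gammaPDF _ _), gammaMeasure]

end IsGammaMixture

/-! ### The two fading laws as gamma mixtures -/

/-- The series of the modified Bessel function converges. -/
theorem hasSum_besselISeries {nu : ℝ} (hnu : 0 < nu + 1) (z : ℝ) :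
    HasSum (fun k : ℕ => (z / 2) ^ (2 * k) / ((Nat.factorial k : ℝ) * Real.Gamma (k + nu + 1)))
      (besselISeries nu z) := by
  refine Summable.hasSum ?_
  set a := nu + 1 with ha
  have hG : 0 < Real.Gamma a := Real.Gamma_pos_of_pos hnu
  -- Iterating the functional equation bounds the Bessel series by an exponential series.
  have hlow : ∀ k : ℕ, a ^ k * Real.Gamma a ≤ Real.Gamma (k + nu + 1) := by
    intro k
    induction k with
    | zero => simp [ha]
    | succ k ih =>
      have hk : 0 < (k : ℝ) + nu + 1 := by have := k.cast_nonneg (α := ℝ); linarith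
      rw [show ((k + 1 : ℕ) : ℝ) + nu + 1 = (k + nu + 1) + 1 by push_cast; ring,
        Real.Gamma_add_one hk.ne', pow_succ']
      have h1 : a ≤ k + nu + 1 := by have := k.cast_nonneg (α := ℝ); linarith
      calc a * a ^ k * Real.Gamma a = a * (a ^ k * Real.Gamma a) := by ring
        _ ≤ (k + nu + 1) * Real.Gamma (k + nu + 1) :=
            mul_le_mul h1 ih (by positivity) hk.le
  refine Summable.of_nonneg_of_le (fun k => ?_) (fun k => ?_)
    ((Real.summable_pow_div_factorial ((z / 2) ^ 2 / a)).mul_left (Real.Gamma a)⁻¹)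
  · have hk : 0 < (k : ℝ) + nu + 1 := by have := k.cast_nonneg (α := ℝ); linarith
    have := Real.Gamma_pos_of_pos hk
    rw [pow_mul]
    positivity
  · have : (Real.Gamma a)⁻¹ * (((z / 2) ^ 2 / a) ^ k / (k.factorial : ℝ)) =
        (z / 2) ^ (2 * k) / ((Nat.factorial k : ℝ) * (a ^ k * Real.Gamma a)) := by
      rw [pow_mul, div_pow]
      field_simp
    rw [this]
    refine div_le_div_of_nonneg_left ?_ (by positivity) ?_
    · rw [pow_mul]; positivity
    · exact mul_le_mul_of_nonneg_left (hlow k) (by positivity)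

/-- Mixture weights of the `κ`-`μ` distribution. -/
noncomputable def kappaMuWeight (kappa mu : ℝ) (n : ℕ) : ℝ :=
  Real.exp (-(mu * kappa)) * ((mu * kappa) ^ n / (n.factorial : ℝ))

/-- The n-th Bessel term carries x^{(μ-1)/2 + (μ-1)/2 + n} = x^{n+μ-1}, a gamma density of shape
n+μ; the constants left over are Poisson weights of mean μκ. -/
theorem isGammaMixture_kappaMuLaw {kappa mu w : ℝ} (hk : 0 < kappa) (hmu : 0 < mu) (hw : 0 < w) :
    IsGammaMixture (kappaMuLaw kappa mu w) (kappaMuWeight kappa mu) (fun n => n + mu)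
      (mu * (1 + kappa) / w) := by
  have hθ : 0 < mu * (1 + kappa) / w := by positivity
  have hc : ∀ n, 0 ≤ kappaMuWeight kappa mu n := fun n => by unfold kappaMuWeight; positivity
  have hβ : ∀ n : ℕ, 0 < (n : ℝ) + mu := fun n => by positivity
  refine ⟨hθ, hc, hβ, ?_, ?_⟩
  · refine IsGammaMixture.withDensity_eq_sum hθ hc hβ (fun x hx => ?_) (fun x hx => ?_)
    · rw [kappaMuPDF, if_neg (by linarith)]
    · rw [kappaMuPDF, if_pos hx, besselI]
      have hs := (hasSum_besselISeries (nu := mu - 1) (by linarith)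
        (2 * mu * Real.sqrt (kappa * (1 + kappa) / w * x)))
      have hs' := (hs.mul_left ((2 * mu * Real.sqrt (kappa * (1 + kappa) / w * x) / 2) ^
        (mu - 1))).mul_left (mu / (kappa ^ ((mu - 1) / 2) * Real.exp (mu * kappa)) *
        ((1 + kappa) / w) ^ ((mu + 1) / 2) * x ^ ((mu - 1) / 2) *
        Real.exp (-(mu * (1 + kappa) / w * x)))
      refine hs'.congr_fun ?_
      intro n
      rw [kappaMuWeight, gammaPDFReal, if_pos hx.le]
      set v := (1 + kappa) / w with hv
      have hv0 : 0 < v := by positivity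
      rw [show 2 * mu * Real.sqrt (kappa * (1 + kappa) / w * x) / 2 =
        mu * Real.sqrt (kappa * v * x) by rw [hv]; ring_nf, show mu * (1 + kappa) / w = mu * v by
          rw [hv]; ring, show (n : ℝ) + (mu - 1) + 1 = n + mu by ring]
      have e1 : (mu * Real.sqrt (kappa * v * x)) ^ (2 * n) = (mu ^ 2 * (kappa * v * x)) ^ n := by
        rw [pow_mul, mul_pow, Real.sq_sqrt (by positivity)]
      have e2 : (mu * Real.sqrt (kappa * v * x)) ^ (mu - 1) = mu ^ mu / mu *
          (kappa ^ ((mu - 1) / 2) * v ^ ((mu - 1) / 2) * x ^ ((mu - 1) / 2)) := by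
        rw [Real.mul_rpow hmu.le (Real.sqrt_nonneg _), Real.rpow_sub_one hmu.ne',
          Real.sqrt_eq_rpow, ← Real.rpow_mul (by positivity),
          show 1 / 2 * (mu - 1) = (mu - 1) / 2 by ring, Real.mul_rpow (by positivity) hx.le,
          Real.mul_rpow hk.le hv0.le]
      have e3 : v ^ ((mu + 1) / 2) = v ^ ((mu - 1) / 2) * v := by
        rw [← Real.rpow_add_one hv0.ne']; ring_nf
      have e4 : ∀ y : ℝ, 0 < y → y ^ mu = y ^ ((mu - 1) / 2) * y ^ ((mu - 1) / 2) * y := by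
        intro y hy
        rw [← Real.rpow_add hy, ← Real.rpow_add_one hy.ne']; ring_nf
      have e5 : x ^ ((n : ℝ) + mu - 1) = x ^ n * x ^ mu / x := by
        rw [Real.rpow_sub_one hx.ne', Real.rpow_add hx, Real.rpow_natCast]
      have e6 : (mu * v) ^ ((n : ℝ) + mu) = (mu * v) ^ n * (mu ^ mu * v ^ mu) := by
        rw [Real.rpow_add (by positivity), Real.rpow_natCast, Real.mul_rpow hmu.le hv0.le]
      have hGn : Real.Gamma (n + mu) ≠ 0 := (Real.Gamma_pos_of_pos (hβ n)).ne'
      have hkp : kappa ^ ((mu - 1) / 2) ≠ 0 := (Real.rpow_pos_of_pos hk _).ne'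
      rw [e1, e2, e3, e5, e6, e4 x hx, e4 v hv0, Real.exp_neg (mu * kappa)]
      simp only [mul_pow]
      field_simp
      ring
  · have hb : ∀ n : ℕ, (n : ℝ) + mu ≤ (1 + mu) * 2 ^ n := by
      intro n
      have h1 : (n : ℝ) ≤ 2 ^ n := by exact_mod_cast n.lt_two_pow_self.le
      have h2 : (1 : ℝ) ≤ 2 ^ n := one_le_pow₀ (by norm_num)
      nlinarith
    refine Summable.of_nonneg_of_le (fun n => mul_nonneg (hc n) (hβ n).le) (fun n => ?_)
      ((Real.summable_pow_div_factorial (2 * (mu * kappa))).mul_left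
        (Real.exp (-(mu * kappa)) * (1 + mu)))
    refine (mul_le_mul_of_nonneg_left (hb n) (hc n)).trans_eq ?_
    rw [kappaMuWeight, mul_pow]
    ring

theorem etaMuh_pos {eta : ℝ} (h : 0 < eta) : 0 < etaMuh eta := by unfold etaMuh; positivity

theorem sq_etaMuH_div_etaMuh_lt_one {eta : ℝ} (h : 0 < eta) :
    (etaMuH eta / etaMuh eta) ^ 2 < 1 := by
  have hh := etaMuh_pos h
  have hi : 0 < eta⁻¹ := inv_pos.2 h
  rw [div_pow, div_lt_one (by positivity)]
  refine sq_lt_sq' ?_ ?_ <;> · unfold etaMuh etaMuH; linarith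

/-- Mixture weights of the `η`-`μ` distribution. -/
noncomputable def etaMuWeight (eta mu : ℝ) (n : ℕ) : ℝ :=
  Real.Gamma (n + mu) / (etaMuh eta ^ mu * Real.Gamma mu * (n.factorial : ℝ)) *
    (etaMuH eta / etaMuh eta) ^ (2 * n)

/-- Legendre's duplication formula, in the form needed for `η`-`μ` fading. -/
theorem Gamma_two_mul_add (mu : ℝ) (n : ℕ) :
    Real.Gamma (2 * n + 2 * mu) * 2 * Real.sqrt Real.pi =
      Real.Gamma (n + mu) * Real.Gamma (n + mu + 1 / 2) * (2 : ℝ) ^ (2 * (n : ℝ) + 2 * mu) := by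
  rw [Real.Gamma_mul_Gamma_add_half, show 2 * ((n : ℝ) + mu) = 2 * n + 2 * mu by ring,
    Real.rpow_sub two_pos, Real.rpow_one]
  have : (0 : ℝ) < 2 ^ (2 * (n : ℝ) + 2 * mu) := by positivity
  field_simp

/-- The n-th Bessel term carries x^{2n+2μ-1}. Duplication trades √π/Γ(n+μ+1/2) for Γ(n+μ)/Γ(2n+2μ),
which supplies the normalisation of the gamma density. Since the series contains only even powers of
H, the weights are nonnegative for every η > 0. -/
theorem isGammaMixture_etaMuLaw {eta mu w : ℝ} (he : 0 < eta) (hmu : 0 < mu) (hw : 0 < w) :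
    IsGammaMixture (etaMuLaw eta mu w) (etaMuWeight eta mu) (fun n => 2 * n + 2 * mu)
      (2 * mu * etaMuh eta / w) := by
  have hh := etaMuh_pos he
  have hGm := Real.Gamma_pos_of_pos hmu
  have hθ : 0 < 2 * mu * etaMuh eta / w := by positivity
  have hG : ∀ n : ℕ, 0 < Real.Gamma (n + mu) := fun n => Real.Gamma_pos_of_pos (by positivity)
  have hc : ∀ n, 0 ≤ etaMuWeight eta mu n := fun n => by
    have := hG n
    rw [etaMuWeight, pow_mul]
    positivity
  have hβ : ∀ n : ℕ, 0 < 2 * (n : ℝ) + 2 * mu := fun n => by positivity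
  refine ⟨hθ, hc, hβ, ?_, ?_⟩
  · refine IsGammaMixture.withDensity_eq_sum hθ hc hβ (fun x hx => ?_) (fun x hx => ?_)
    · rw [etaMuPDF, if_neg (by linarith)]
    · rw [etaMuPDF, if_pos hx]
      have hs := hasSum_besselISeries (nu := mu - 1 / 2) (by linarith)
        (2 * mu * etaMuH eta * x / w)
      have hs' := (hs.mul_left ((mu * x / w) ^ (mu - 1 / 2))).mul_left
        (2 * Real.sqrt Real.pi * mu ^ (mu + 1 / 2) * etaMuh eta ^ mu /
        (Real.Gamma mu * w ^ (mu + 1 / 2)) * x ^ (mu - 1 / 2) *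
        Real.exp (-(2 * mu * etaMuh eta * x / w)))
      refine hs'.congr_fun ?_
      intro n
      rw [etaMuWeight, gammaPDFReal, if_pos hx.le]
      rw [show 2 * mu * etaMuH eta * x / w / 2 = mu * etaMuH eta * x / w by ring,
        show 2 * mu * etaMuh eta * x / w = 2 * mu * etaMuh eta / w * x by ring,
        show (n : ℝ) + (mu - 1 / 2) + 1 = n + mu + 1 / 2 by ring]
      have hdup := Gamma_two_mul_add mu n
      have hG1 : 0 < Real.Gamma (n + mu + 1 / 2) := Real.Gamma_pos_of_pos (by positivity)
      have hG2 : 0 < Real.Gamma (2 * n + 2 * mu) := Real.Gamma_pos_of_pos (by positivity)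
      have half : ∀ y : ℝ, 0 < y → y ^ (mu + 1 / 2) = y ^ mu * Real.sqrt y := by
        intro y hy
        rw [Real.rpow_add hy, ← Real.sqrt_eq_rpow]
      have half' : ∀ y : ℝ, 0 < y → y ^ (mu - 1 / 2) = y ^ mu / Real.sqrt y := by
        intro y hy
        rw [Real.rpow_sub hy, ← Real.sqrt_eq_rpow]
      have hdbl : ∀ y : ℝ, 0 < y → y ^ (2 * (n : ℝ) + 2 * mu) = y ^ (2 * n) * (y ^ mu * y ^ mu) := by
        intro y hy
        rw [Real.rpow_add hy, ← Real.rpow_add hy mu mu, ← two_mul, ← Real.rpow_natCast]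
        push_cast
        rfl
      rw [hdbl 2 two_pos] at hdup
      have e1 : (mu * x / w) ^ (mu - 1 / 2) = mu ^ mu / √mu * (x ^ mu / √x) / (w ^ mu / √w) := by
        rw [Real.div_rpow (by positivity) hw.le, Real.mul_rpow hmu.le hx.le, half' _ hmu,
          half' _ hx, half' _ hw]
      have e2 : (2 * mu * etaMuh eta / w) ^ (2 * (n : ℝ) + 2 * mu) =
          (2 * mu * etaMuh eta / w) ^ (2 * n) *
            (2 ^ mu * mu ^ mu * etaMuh eta ^ mu / w ^ mu) ^ 2 := by
        rw [hdbl _ hθ, Real.div_rpow (by positivity) hw.le, Real.mul_rpow (by positivity) hh.le,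
          Real.mul_rpow two_pos.le hmu.le]
        ring
      rw [e1, e2, half _ hmu, half _ hw, half' _ hx, Real.rpow_sub_one hx.ne', hdbl x hx]
      have hr1 : Real.sqrt x * Real.sqrt x = x := Real.mul_self_sqrt hx.le
      have hGn := hG n
      have key : Real.sqrt Real.pi * 2 / Real.Gamma (n + mu + 1 / 2) =
          Real.Gamma (n + mu) * (2 ^ (2 * n) * (2 ^ mu * 2 ^ mu)) / Real.Gamma (2 * n + 2 * mu) := by
        rw [div_eq_div_iff hG1.ne' hG2.ne']
        linarith
      -- The exponential is generalised to E, and the square roots are paired off to isolate the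
      -- quotient that duplication rewrites.
      have e3 : ∀ E : ℝ, 2 * √Real.pi * (mu ^ mu * √mu) * etaMuh eta ^ mu /
          (Real.Gamma mu * (w ^ mu * √w)) * (x ^ mu / √x) * E *
          (mu ^ mu / √mu * (x ^ mu / √x) / (w ^ mu / √w) * ((mu * etaMuH eta * x / w) ^ (2 * n) /
            (n.factorial * Real.Gamma (n + mu + 1 / 2)))) =
          (√Real.pi * 2 / Real.Gamma (n + mu + 1 / 2)) * ((mu ^ mu * x ^ mu / w ^ mu) ^ 2 *
            etaMuh eta ^ mu * (mu * etaMuH eta * x / w) ^ (2 * n) * E /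
              (x * Real.Gamma mu * n.factorial)) := by
        intro E
        rw [show (mu ^ mu * x ^ mu / w ^ mu) ^ 2 * etaMuh eta ^ mu *
            (mu * etaMuH eta * x / w) ^ (2 * n) * E / (x * Real.Gamma mu * n.factorial) =
            (mu ^ mu * x ^ mu / w ^ mu) ^ 2 * etaMuh eta ^ mu *
            (mu * etaMuH eta * x / w) ^ (2 * n) * E /
              ((√x * √x) * Real.Gamma mu * n.factorial) by rw [hr1]]
        field_simp
      rw [e3, key]
      simp only [mul_pow, div_pow]
      field_simp
  · set ρ := (etaMuH eta / etaMuh eta) ^ 2 with hρ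
    have hρ0 : 0 ≤ ρ := sq_nonneg _
    obtain ⟨q, hq, hq1⟩ := exists_between (sq_etaMuH_div_etaMuh_lt_one he)
    have hlim : Filter.Tendsto (fun n : ℕ => ρ + ρ * mu * (1 / ((n : ℝ) + 1))) Filter.atTop
        (𝓝 ρ) := by
      simpa using (tendsto_one_div_add_atTop_nhds_zero_nat (𝕜 := ℝ)).const_mul (ρ * mu)
        |>.const_add ρ
    refine summable_of_ratio_norm_eventually_le hq1 ?_
    filter_upwards [hlim.eventually (eventually_lt_nhds hq)] with n hn
    rw [Real.norm_of_nonneg (mul_nonneg (hc _) (hβ _).le),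
      Real.norm_of_nonneg (mul_nonneg (hc _) (hβ _).le)]
    -- Consecutive terms have the exact ratio ρ(1 + μ/(n+1)), which tends to ρ < 1; q was chosen
    -- strictly between.
    have e : etaMuWeight eta mu (n + 1) * (2 * ((n + 1 : ℕ) : ℝ) + 2 * mu) =
        (ρ + ρ * mu * (1 / ((n : ℝ) + 1))) * (etaMuWeight eta mu n * (2 * n + 2 * mu)) := by
      have hnm : (n : ℝ) + mu ≠ 0 := by positivity
      have hn1 : (n : ℝ) + 1 ≠ 0 := by positivity
      simp only [etaMuWeight]
      rw [show ((n + 1 : ℕ) : ℝ) + mu = (n + mu) + 1 by push_cast; ring,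
        Real.Gamma_add_one hnm, Nat.factorial_succ, pow_mul, pow_mul, pow_succ, ← hρ]
      push_cast
      field_simp
    rw [e]
    exact mul_le_mul_of_nonneg_right hn.le (mul_nonneg (hc _) (hβ _).le)

/-! ### The mark transform as a series of incomplete beta integrals -/

theorem cellRadius_pos {lamb : ℝ} (h : 0 < lamb) : 0 < cellRadius lamb := by
  unfold cellRadius
  have := Real.pi_pos
  positivity

theorem cellRadius_rpow {lamb : ℝ} (h : 0 < lamb) {tau : ℝ} :
    cellRadius lamb ^ tau = ((Real.pi * lamb) ^ (1 / (2 / tau)))⁻¹ := by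
  have hp : 0 < Real.pi * lamb := mul_pos Real.pi_pos h
  rw [cellRadius, Real.sqrt_eq_rpow, ← Real.rpow_mul (by positivity), one_div,
    Real.inv_rpow hp.le]
  congr 2
  rw [one_div_div]
  ring

/-- Expectation over the mark `(L, G)` of the factor `exp(-s L^τ G r^{-τ})` contributed by a point
at distance `r`. -/
noncomputable def markTransform (lamb tau s : ℝ) (law : Measure ℝ) (r : ℝ) : ℝ≥0∞ :=
  ∫⁻ p, ENNReal.ofReal (Real.exp (-(s * (p.1 ^ tau * p.2 * r ^ (-tau)))))
    ∂((cellularLinkLaw lamb).prod law)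

theorem measurable_markTransform (lamb tau s : ℝ) (law : Measure ℝ) [SFinite law]
    [SFinite (cellularLinkLaw lamb)] :
    Measurable (markTransform lamb tau s law) := by
  unfold markTransform
  exact Measurable.lintegral_prod_right (f := fun (r : ℝ) (p : ℝ × ℝ) =>
    ENNReal.ofReal (Real.exp (-(s * (p.1 ^ tau * p.2 * r ^ (-tau)))))) (by
      unfold Function.uncurry
      fun_prop)

theorem lintegral_cellularLinkLaw (lamb : ℝ) {F : ℝ → ℝ≥0∞} (hF : Measurable F) :
    ∫⁻ l, F l ∂(cellularLinkLaw lamb) =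
      ∫⁻ l in Set.Ioc 0 (cellRadius lamb), ENNReal.ofReal (2 * Real.pi * lamb * l) * F l := by
  have hm : Measurable ((Set.Icc 0 (cellRadius lamb)).indicator fun x =>
      ENNReal.ofReal (2 * Real.pi * lamb * x)) :=
    Measurable.indicator (by fun_prop) measurableSet_Icc
  rw [cellularLinkLaw, lintegral_withDensity_eq_lintegral_mul _ hm hF,
    restrict_Ioc_eq_restrict_Icc, ← lintegral_indicator measurableSet_Icc]
  refine lintegral_congr fun l => ?_
  simp only [Pi.mul_apply, Set.indicator_mul_left]

theorem ae_mem_Icc_cellularLinkLaw (lamb : ℝ) :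
    ∀ᵐ l ∂(cellularLinkLaw lamb), l ∈ Set.Icc 0 (cellRadius lamb) := by
  rw [cellularLinkLaw, withDensity_indicator measurableSet_Icc]
  exact (withDensity_absolutelyContinuous _ _).ae_le (ae_restrict_mem measurableSet_Icc)

/-- The substitution `t = a l^τ` in the incomplete beta integral. -/
theorem lintegral_link_eq_incompleteBeta {a tau b R : ℝ} (ha : 0 < a) (htau : 0 < tau)
    (hb : 0 ≤ b) (hR : 0 < R) :
    ∫⁻ l in Set.Ioc 0 R, ENNReal.ofReal (2 * l * (1 + a * l ^ tau) ^ (-b)) =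
      ENNReal.ofReal (2 / tau * a ^ (-(2 / tau)) *
        incompleteBeta (2 / tau) b (a * R ^ tau)) := by
  have hd : 0 < 2 / tau := by positivity
  let f : ℝ → ℝ := fun l => a * l ^ tau
  let f' : ℝ → ℝ := fun l => a * (tau * l ^ (tau - 1))
  have himg : f '' Set.Ioc 0 R = Set.Ioc 0 (a * R ^ tau) := by
    ext t
    constructor
    · rintro ⟨l, ⟨h0, h1⟩, rfl⟩
      exact ⟨by positivity, mul_le_mul_of_nonneg_left (Real.rpow_le_rpow h0.le h1 htau.le) ha.le⟩
    · rintro ⟨h0, h1⟩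
      have hta : 0 < t / a := by positivity
      refine ⟨(t / a) ^ tau⁻¹, ⟨by positivity, ?_⟩, ?_⟩
      · rw [Real.rpow_inv_le_iff_of_pos hta.le hR.le htau, div_le_iff₀ ha]
        linarith
      · simp only [f]
        rw [Real.rpow_inv_rpow hta.le htau.ne']
        field_simp
  have hderiv : ∀ l ∈ Set.Ioc 0 R, HasDerivWithinAt f (f' l) (Set.Ioc 0 R) l := by
    intro l hl
    exact ((Real.hasDerivAt_rpow_const (Or.inl hl.1.ne')).const_mul a).hasDerivWithinAt
  have hinj : Set.InjOn f (Set.Ioc 0 R) := by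
    intro x hx y hy h
    have h : x ^ tau = y ^ tau := mul_left_cancel₀ ha.ne' h
    exact Real.rpow_left_injOn htau.ne' hx.1.le hy.1.le h
  have hcv := lintegral_image_eq_lintegral_abs_deriv_mul measurableSet_Ioc hderiv hinj
    fun t => ENNReal.ofReal (t ^ (2 / tau - 1) * (1 + t) ^ (-b))
  rw [himg] at hcv
  have hnn : 0 ≤ᵐ[volume.restrict (Set.Ioc 0 (a * R ^ tau))]
      fun t : ℝ => t ^ (2 / tau - 1) * (1 + t) ^ (-b) := by
    filter_upwards [ae_restrict_mem measurableSet_Ioc] with t ht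
    have : 0 < t := ht.1
    simp only [Pi.zero_apply]
    positivity
  rw [ENNReal.ofReal_mul (by positivity), incompleteBeta,
    ofReal_integral_eq_lintegral_ofReal (integrableOn_incompleteBeta hd hb _) hnn, hcv,
    ← lintegral_const_mul' _ _ ofReal_ne_top]
  refine setLIntegral_congr_fun measurableSet_Ioc fun l hl => ?_
  have hl0 : 0 < l := hl.1
  simp only [f, f']
  rw [abs_of_pos (by positivity), ← ENNReal.ofReal_mul (by positivity),
    ← ENNReal.ofReal_mul (by positivity)]
  congr 1
  have e1 : (a * l ^ tau) ^ (2 / tau - 1) = a ^ (2 / tau) / a * (l ^ 2 / l ^ tau) := by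
    rw [Real.mul_rpow ha.le (by positivity), Real.rpow_sub_one ha.ne', ← Real.rpow_mul hl0.le,
      show tau * (2 / tau - 1) = 2 - tau by field_simp, Real.rpow_sub hl0, Real.rpow_two]
  rw [e1, Real.rpow_neg ha.le, Real.rpow_sub_one hl0.ne']
  have := (Real.rpow_pos_of_pos ha (2 / tau)).ne'
  have := (Real.rpow_pos_of_pos hl0 tau).ne'
  field_simp

/-- The factor `πλ r² δ (θ/s)^δ` in front of the series in `φ`. -/
noncomputable def phiFactor (lamb tau s θ r : ℝ) : ℝ :=
  Real.pi * lamb * r ^ 2 * (2 / tau) * (θ / s) ^ (2 / tau)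

/-- The upper limit `s / (θ (πλ)^{1/δ} r^τ)` of the incomplete beta integrals in `φ`. -/
noncomputable def phiLimit (lamb tau s θ r : ℝ) : ℝ :=
  (θ * (Real.pi * lamb) ^ (1 / (2 / tau)) * r ^ tau / s)⁻¹

section MarkTransform

variable {law : Measure ℝ} {c β : ℕ → ℝ} {θ : ℝ}

/-- Tonelli, with the fading integrated first: each gamma component gives (1 + a l^τ)^{-β_n}, and
the link integral is then an incomplete beta integral. Its upper limit a R^τ is `phiLimit` because
R^τ = (πλ)^{-1/δ}. Working in [0, ∞] leaves no convergence to check. -/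
theorem IsGammaMixture.markTransform_eq_tsum (h : IsGammaMixture law c β θ) [SFinite law]
    {lamb tau s r : ℝ} (hlamb : 0 < lamb) (htau : 0 < tau) (hs : 0 < s) (hr : 0 < r) :
    markTransform lamb tau s law r = ∑' n, ENNReal.ofReal (phiFactor lamb tau s θ r *
      (c n * incompleteBeta (2 / tau) (β n) (phiLimit lamb tau s θ r))) := by
  have hθ := h.rate_pos
  have hpi := Real.pi_pos
  set a : ℝ := s * r ^ (-tau) / θ with ha
  have ha0 : 0 < a := by positivity
  have hlim : a * cellRadius lamb ^ tau = phiLimit lamb tau s θ r := by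
    rw [cellRadius_rpow hlamb, ha, phiLimit, Real.rpow_neg hr.le]
    have : 0 < (Real.pi * lamb) ^ (1 / (2 / tau)) := by positivity
    field_simp
  have hfac : Real.pi * lamb * (2 / tau * a ^ (-(2 / tau))) = phiFactor lamb tau s θ r := by
    have e : a ^ (-(2 / tau)) = r ^ 2 * (θ / s) ^ (2 / tau) := by
      rw [Real.rpow_neg ha0.le, ← Real.inv_rpow ha0.le,
        show a⁻¹ = r ^ tau * (θ / s) by rw [ha, Real.rpow_neg hr.le]; field_simp,
        Real.mul_rpow (by positivity) (by positivity), ← Real.rpow_mul hr.le,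
        show tau * (2 / tau) = 2 by field_simp, Real.rpow_two]
    rw [e, phiFactor]
    ring
  have hinner : ∀ l ∈ Set.Ioc 0 (cellRadius lamb),
      ENNReal.ofReal (2 * Real.pi * lamb * l) *
        ∫⁻ g, ENNReal.ofReal (Real.exp (-(s * (l ^ tau * g * r ^ (-tau))))) ∂law =
      ∑' n, ENNReal.ofReal (Real.pi * lamb * c n) *
        ENNReal.ofReal (2 * l * (1 + a * l ^ tau) ^ (-(β n))) := by
    intro l hl
    have hl0 : 0 < l := hl.1
    have e : ∀ g, s * (l ^ tau * g * r ^ (-tau)) = (s * l ^ tau * r ^ (-tau)) * g := by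
      intro g; ring
    simp_rw [e]
    rw [h.lintegral_exp (by positivity), ← ENNReal.tsum_mul_left]
    refine tsum_congr fun n => ?_
    have hc := h.weight_nonneg n
    rw [← ENNReal.ofReal_mul (by positivity), ← ENNReal.ofReal_mul (by positivity),
      show s * l ^ tau * r ^ (-tau) / θ = a * l ^ tau by rw [ha]; ring]
    congr 1
    ring
  have hF : Measurable fun l : ℝ =>
      ∫⁻ g, ENNReal.ofReal (Real.exp (-(s * (l ^ tau * g * r ^ (-tau))))) ∂law :=
    Measurable.lintegral_prod_right (f := fun (l g : ℝ) =>
      ENNReal.ofReal (Real.exp (-(s * (l ^ tau * g * r ^ (-tau)))))) (by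
        unfold Function.uncurry
        fun_prop)
  rw [markTransform, lintegral_prod _ (by fun_prop), lintegral_cellularLinkLaw _ hF,
    setLIntegral_congr_fun measurableSet_Ioc hinner, lintegral_tsum fun n => by fun_prop]
  refine tsum_congr fun n => ?_
  have hc := h.weight_nonneg n
  rw [lintegral_const_mul' _ _ ofReal_ne_top,
    lintegral_link_eq_incompleteBeta ha0 htau (h.shape_pos n).le
      (cellRadius_pos hlamb), hlim,
    ← ENNReal.ofReal_mul (by positivity), ← hfac]
  congr 1
  ring

theorem incompleteBeta_nonneg (d b x : ℝ) : 0 ≤ incompleteBeta d b x := by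
  refine setIntegral_nonneg measurableSet_Ioc fun t ht => ?_
  have : 0 < t := ht.1
  positivity

theorem phiFactor_pos {lamb tau s θ r : ℝ} (hlamb : 0 < lamb) (htau : 0 < tau) (hs : 0 < s)
    (hθ : 0 < θ) (hr : 0 < r) : 0 < phiFactor lamb tau s θ r := by
  have := Real.pi_pos
  unfold phiFactor
  positivity

/-- The mark transform evaluates to the series of incomplete beta integrals. -/
theorem IsGammaMixture.hasSum_markTransform (h : IsGammaMixture law c β θ) [SFinite law]
    {lamb tau s r : ℝ} (hlamb : 0 < lamb) (htau : 0 < tau) (hs : 0 < s) (hr : 0 < r)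
    (hfin : markTransform lamb tau s law r ≠ ⊤) :
    (Summable fun n => c n * incompleteBeta (2 / tau) (β n) (phiLimit lamb tau s θ r)) ∧
      (markTransform lamb tau s law r).toReal = phiFactor lamb tau s θ r *
        ∑' n, c n * incompleteBeta (2 / tau) (β n) (phiLimit lamb tau s θ r) := by
  have hK := phiFactor_pos hlamb htau hs h.rate_pos hr
  have hnn : ∀ n, 0 ≤ phiFactor lamb tau s θ r *
      (c n * incompleteBeta (2 / tau) (β n) (phiLimit lamb tau s θ r)) := fun n =>
    mul_nonneg hK.le (mul_nonneg (h.weight_nonneg n) (incompleteBeta_nonneg _ _ _))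
  rw [h.markTransform_eq_tsum hlamb htau hs hr] at hfin ⊢
  have hsum := ENNReal.summable_toReal hfin
  simp only [fun n => toReal_ofReal (hnn n)] at hsum
  refine ⟨(summable_mul_left_iff hK.ne').1 hsum, ?_⟩
  rw [← ofReal_tsum_of_nonneg hnn hsum, toReal_ofReal (tsum_nonneg hnn), tsum_mul_left]

end MarkTransform

/-! ### Averaging over the marks -/

/-- For points carrying i.i.d. marks which are independent of the points, finite products can be
averaged over the marks first. -/
theorem lintegral_prod_marks {Ω α γ : Type*} [MeasurableSpace Ω] [MeasurableSpace α]
    [MeasurableSpace γ] {P : Measure Ω} [IsProbabilityMeasure P] {X : ℕ → Ω → α} {Z : ℕ → Ω → γ}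
    {Q : Measure γ} [SFinite Q] (hX : ∀ j, Measurable (X j)) (hZ : ∀ j, Measurable (Z j))
    (hQ : ∀ j, P.map (Z j) = Q) (hind : iIndepFun Z P)
    (hXZ : IndepFun (fun ω j => X j ω) (fun ω j => Z j ω) P) {g : α × γ → ℝ≥0∞}
    (hg : Measurable g) (N : ℕ) :
    ∫⁻ ω, ∏ j ∈ Finset.range N, g (X j ω, Z j ω) ∂P =
      ∫⁻ ω, ∏ j ∈ Finset.range N, ∫⁻ z, g (X j ω, z) ∂Q ∂P := by
  have hXm : Measurable fun ω j => X j ω := measurable_pi_lambda _ hX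
  have hZm : Measurable fun ω j => Z j ω := measurable_pi_lambda _ hZ
  -- Independence of the whole sequences of points and marks makes their joint law a product, so the
  -- points can be frozen while the marks are averaged.
  have hprod := (indepFun_iff_map_prod_eq_prod_map_map hXm.aemeasurable hZm.aemeasurable).1 hXZ
  have hF : Measurable fun p : (ℕ → α) × (ℕ → γ) =>
      ∏ j ∈ Finset.range N, g (p.1 j, p.2 j) := by
    refine Finset.measurable_prod _ fun j _ => hg.comp ?_
    exact ((measurable_pi_apply j).comp measurable_fst).prodMk
      ((measurable_pi_apply j).comp measurable_snd)
  have := Measure.isProbabilityMeasure_map (μ := P) hZm.aemeasurable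
  have h1 : ∫⁻ ω, ∏ j ∈ Finset.range N, g (X j ω, Z j ω) ∂P =
      ∫⁻ p, ∏ j ∈ Finset.range N, g (p.1 j, p.2 j)
        ∂(P.map fun ω => ((fun j => X j ω), fun j => Z j ω)) :=
    (lintegral_map hF (hXm.prodMk hZm)).symm
  have h2 : ∀ x : ℕ → α, ∫⁻ z, ∏ j ∈ Finset.range N, g (x j, z j) ∂(P.map fun ω j => Z j ω) =
      ∏ j ∈ Finset.range N, ∫⁻ z, g (x j, z) ∂Q := by
    intro x
    have hgx : ∀ j, Measurable fun z => g (x j, z) := fun j => hg.comp measurable_prodMk_left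
    rw [lintegral_map (f := fun z : ℕ → γ => ∏ j ∈ Finset.range N, g (x j, z j))
      (Finset.measurable_prod _ fun j _ => (hgx j).comp (measurable_pi_apply j)) hZm]
    have hc := hind.comp (fun j z => g (x j, z)) hgx
    have key := lintegral_prod_eq_prod_lintegral_of_indepFun (Finset.range N) _ hc
      fun j => (hgx j).comp (hZ j)
    simp only [Function.comp_def] at key
    rw [key]
    refine Finset.prod_congr rfl fun j _ => ?_
    rw [← hQ j, lintegral_map (hgx j) (hZ j)]
  rw [h1, hprod, lintegral_prod _ hF.aemeasurable]
  simp only [h2]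
  rw [lintegral_map _ hXm]
  refine Finset.measurable_prod _ fun j _ => ?_
  exact (hg.lintegral_prod_right').comp (measurable_pi_apply j)

namespace IsUplinkModel

variable {Ω : Type*} [MeasurableSpace Ω] {P : Measure Ω} [IsProbabilityMeasure P]
  {X : ℕ → Ω → Plane} {L G : ℕ → Ω → ℝ} {lamb tau s : ℝ} {law : Measure ℝ} {c β : ℕ → ℝ} {θ : ℝ}

theorem isProbabilityMeasure_fading (h : IsUplinkModel P X L G lamb law) :
    IsProbabilityMeasure law := by
  rw [← h.fading_law 0]
  exact Measure.isProbabilityMeasure_map (h.measurable_fading 0).aemeasurable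

theorem isProbabilityMeasure_link (h : IsUplinkModel P X L G lamb law) :
    IsProbabilityMeasure (cellularLinkLaw lamb) := by
  rw [← h.link_law 0]
  exact Measure.isProbabilityMeasure_map (h.measurable_link 0).aemeasurable

theorem map_mark (h : IsUplinkModel P X L G lamb law) (j : ℕ) :
    P.map (fun ω => (L j ω, G j ω)) = (cellularLinkLaw lamb).prod law := by
  rw [(indepFun_iff_map_prod_eq_prod_map_map (h.measurable_link j).aemeasurable
    (h.measurable_fading j).aemeasurable).1 (h.link_indep_fading j), h.link_law, h.fading_law]

theorem ae_mark (h : IsUplinkModel P X L G lamb law) (hlaw : IsGammaMixture law c β θ) :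
    ∀ᵐ p ∂((cellularLinkLaw lamb).prod law),
      0 ≤ p.1 ∧ p.1 ≤ cellRadius lamb ∧ 0 ≤ p.2 := by
  have := h.isProbabilityMeasure_fading
  have := h.isProbabilityMeasure_link
  filter_upwards [Measure.quasiMeasurePreserving_fst.ae (ae_mem_Icc_cellularLinkLaw lamb),
    Measure.quasiMeasurePreserving_snd.ae hlaw.ae_nonneg] with p h1 h2
  exact ⟨h1.1, h1.2, h2⟩

theorem ae_interferenceTerm_nonneg (h : IsUplinkModel P X L G lamb law)
    (hlaw : IsGammaMixture law c β θ) :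
    ∀ᵐ ω ∂P, ∀ j, 0 ≤ interferenceTerm X L G lamb tau j ω := by
  refine ae_all_iff.2 fun j => ?_
  have hm : Measurable fun ω => (L j ω, G j ω) :=
    (h.measurable_link j).prodMk (h.measurable_fading j)
  have := h.ae_mark hlaw
  rw [← h.map_mark j] at this
  filter_upwards [ae_of_ae_map hm.aemeasurable this] with ω hω
  unfold interferenceTerm
  refine Set.indicator_nonneg (fun x _ => ?_) _
  exact mul_nonneg (mul_nonneg (Real.rpow_nonneg hω.1 _) hω.2.2)
    (Real.rpow_nonneg (norm_nonneg _) _)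

/-- The mean of `L^τ G` is finite. -/
theorem lintegral_mark_ne_top (h : IsUplinkModel P X L G lamb law)
    (hlaw : IsGammaMixture law c β θ) (htau : 0 ≤ tau) :
    ∫⁻ p, ENNReal.ofReal (p.1 ^ tau * p.2) ∂((cellularLinkLaw lamb).prod law) ≠ ⊤ := by
  have := h.isProbabilityMeasure_fading
  have := h.isProbabilityMeasure_link
  have hle : ∫⁻ p, ENNReal.ofReal (p.1 ^ tau * p.2) ∂((cellularLinkLaw lamb).prod law) ≤
      ∫⁻ p, ENNReal.ofReal (cellRadius lamb ^ tau) * ENNReal.ofReal p.2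
        ∂((cellularLinkLaw lamb).prod law) := by
    refine lintegral_mono_ae ?_
    filter_upwards [h.ae_mark hlaw] with p hp
    rw [← ENNReal.ofReal_mul (Real.rpow_nonneg (hp.1.trans hp.2.1) _)]
    exact ENNReal.ofReal_le_ofReal
      (mul_le_mul_of_nonneg_right (Real.rpow_le_rpow hp.1 hp.2.1 htau) hp.2.2)
  refine (hle.trans_lt ?_).ne
  rw [lintegral_const_mul' _ _ ofReal_ne_top, lintegral_prod _ (by fun_prop)]
  simp only [lintegral_const, measure_univ, mul_one]
  exact ENNReal.mul_lt_top ofReal_lt_top hlaw.lintegral_id_ne_top.lt_top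

end IsUplinkModel

/-! ### Finiteness and Laplace transform of the interference -/

theorem measurableSet_compl_cell (lamb : ℝ) : MeasurableSet (cell lamb)ᶜ :=
  measurableSet_ball.compl

theorem mem_compl_cell {lamb : ℝ} {x : Plane} : x ∈ (cell lamb)ᶜ ↔ cellRadius lamb ≤ ‖x‖ := by
  simp [cell]

/-- Integration of radial functions over the complement of the cell. -/
theorem integral_compl_cell {lamb : ℝ} (hlamb : 0 < lamb) (F : ℝ → ℝ) :
    (Integrable (fun x : Plane => (Set.Ici (cellRadius lamb)).indicator F ‖x‖) ↔
      IntegrableOn (fun r => F r * r) (Set.Ioi (cellRadius lamb))) ∧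
    ∫ x : Plane, (Set.Ici (cellRadius lamb)).indicator F ‖x‖ =
      2 * Real.pi * ∫ r in Set.Ioi (cellRadius lamb), F r * r := by
  have hR := cellRadius_pos hlamb
  have hdim : Module.finrank ℝ Plane = 2 := by simp
  have hball : (volume : Measure Plane).real (Metric.ball 0 1) = Real.pi := by
    simp [Measure.real, EuclideanSpace.volume_ball_fin_two, Real.pi_pos.le]
  have hfun : (fun y : ℝ => y ^ (Module.finrank ℝ Plane - 1) •
      (Set.Ici (cellRadius lamb)).indicator F y) =
      (Set.Ici (cellRadius lamb)).indicator fun r => F r * r := by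
    ext y
    rw [hdim]
    by_cases hy : y ∈ Set.Ici (cellRadius lamb)
    · simp [Set.indicator_of_mem hy, mul_comm]
    · simp [Set.indicator_of_notMem hy]
  have hinter : Set.Ici (cellRadius lamb) ∩ Set.Ioi 0 = Set.Ici (cellRadius lamb) :=
    Set.inter_eq_left.2 fun y hy => hR.trans_le hy
  constructor
  · rw [integrable_fun_norm_addHaar, hfun, IntegrableOn, integrable_indicator_iff measurableSet_Ici,
      IntegrableOn, Measure.restrict_restrict measurableSet_Ici, hinter, ← IntegrableOn,
      integrableOn_Ici_iff_integrableOn_Ioi]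
  · rw [integral_fun_norm_addHaar, hfun, integral_indicator measurableSet_Ici,
      Measure.restrict_restrict measurableSet_Ici, hinter, integral_Ici_eq_integral_Ioi, hball,
      hdim]
    simp [mul_assoc]

theorem lintegral_compl_cell_rpow_ne_top {lamb tau : ℝ} (hlamb : 0 < lamb) (htau : 2 < tau) :
    ∫⁻ x : Plane, (cell lamb)ᶜ.indicator (fun x => ENNReal.ofReal (‖x‖ ^ (-tau))) x ≠ ⊤ := by
  have hR := cellRadius_pos hlamb
  have hint : Integrable
      (fun x : Plane => (Set.Ici (cellRadius lamb)).indicator (fun r => r ^ (-tau)) ‖x‖) := by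
    rw [(integral_compl_cell hlamb _).1]
    -- The planar Jacobian r turns the exponent into 1 - τ, which is below -1 exactly when τ > 2.
    refine (integrableOn_Ioi_rpow_of_lt (show 1 - tau < -1 by linarith) hR).congr_fun
      (fun r hr => ?_) measurableSet_Ioi
    have hr0 : 0 < r := hR.trans hr
    simp only
    rw [← Real.rpow_add_one hr0.ne']
    ring_nf
  refine ne_of_eq_of_ne (lintegral_congr fun x => ?_) hint.lintegral_lt_top.ne
  by_cases hx : cellRadius lamb ≤ ‖x‖
  · rw [Set.indicator_of_mem (mem_compl_cell.2 hx), Set.indicator_of_mem (Set.mem_Ici.2 hx)]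
  · rw [Set.indicator_of_notMem (fun h => hx (mem_compl_cell.1 h)),
      Set.indicator_of_notMem (fun h => hx (Set.mem_Ici.1 h)), ENNReal.ofReal_zero]

/-- A preimage of `y ≤ 1` under `x ↦ e⁻ˣ`. -/
theorem ENNReal.expNeg_toENNReal_neg_log {y : ℝ≥0∞} (hy : y ≤ 1) :
    expNeg ((-(ENNReal.log y)).toENNReal) = y := by
  have h0 : 0 ≤ -(ENNReal.log y) := by
    rw [EReal.neg_nonneg]
    exact (ENNReal.log_le_zero_iff).2 hy
  rw [expNeg, EReal.coe_toENNReal h0, neg_neg, ENNReal.exp_log]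

namespace IsUplinkModel

variable {Ω : Type*} [MeasurableSpace Ω] {P : Measure Ω} [IsProbabilityMeasure P]
  {X : ℕ → Ω → Plane} {L G : ℕ → Ω → ℝ} {lamb tau s : ℝ} {law : Measure ℝ} {c β : ℕ → ℝ} {θ : ℝ}

/-- The interference is almost surely finite. -/
theorem ae_summable (h : IsUplinkModel P X L G lamb law) (hlaw : IsGammaMixture law c β θ)
    (hlamb : 0 < lamb) (htau : 2 < tau) :
    ∀ᵐ ω ∂P, Summable fun j => interferenceTerm X L G lamb tau j ω := by
  let k : Plane → ℝ≥0∞ := (cell lamb)ᶜ.indicator fun x => ENNReal.ofReal (‖x‖ ^ (-tau))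
  have hk : Measurable k := Measurable.indicator (by fun_prop) (measurableSet_compl_cell lamb)
  have hm : ∀ j, Measurable fun ω => (L j ω, G j ω) := fun j =>
    (h.measurable_link j).prodMk (h.measurable_fading j)
  have hq : Measurable fun p : ℝ × ℝ => ENNReal.ofReal (p.1 ^ tau * p.2) := by fun_prop
  have hterm : ∀ j ω, ENNReal.ofReal (interferenceTerm X L G lamb tau j ω) =
      k (X j ω) * ENNReal.ofReal (L j ω ^ tau * G j ω) := by
    intro j ω
    simp only [interferenceTerm, k]
    by_cases hx : X j ω ∈ (cell lamb)ᶜ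
    · rw [Set.indicator_of_mem hx, Set.indicator_of_mem hx,
        ENNReal.ofReal_mul' (Real.rpow_nonneg (norm_nonneg _) _), mul_comm]
    · rw [Set.indicator_of_notMem hx, Set.indicator_of_notMem hx, ENNReal.ofReal_zero, zero_mul]
  have hint : ∀ j, ∫⁻ ω, ENNReal.ofReal (interferenceTerm X L G lamb tau j ω) ∂P =
      (∫⁻ ω, k (X j ω) ∂P) *
        ∫⁻ p, ENNReal.ofReal (p.1 ^ tau * p.2) ∂((cellularLinkLaw lamb).prod law) := by
    intro j
    simp_rw [hterm]
    have hi : IndepFun (fun ω => k (X j ω)) (fun ω => ENNReal.ofReal (L j ω ^ tau * G j ω)) P :=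
      h.marks_indep_points.comp (φ := fun x : ℕ → Plane => k (x j))
        (ψ := fun z : ℕ → ℝ × ℝ => ENNReal.ofReal ((z j).1 ^ tau * (z j).2))
        (hk.comp (measurable_pi_apply j)) (hq.comp (measurable_pi_apply j))
    rw [← h.map_mark j, lintegral_map hq (hm j)]
    exact lintegral_mul_eq_lintegral_mul_lintegral_of_indepFun''
      (hk.comp (h.ppp.measurable j)).aemeasurable (hq.comp (hm j)).aemeasurable hi
  have hmeas : ∀ j, Measurable fun ω => ENNReal.ofReal (interferenceTerm X L G lamb tau j ω) := by
    intro j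
    simp_rw [hterm]
    exact (hk.comp (h.ppp.measurable j)).mul (hq.comp (hm j))
  have htot : ∫⁻ ω, ∑' j, ENNReal.ofReal (interferenceTerm X L G lamb tau j ω) ∂P ≠ ⊤ := by
    rw [lintegral_tsum fun j => (hmeas j).aemeasurable]
    simp_rw [hint]
    rw [ENNReal.tsum_mul_right, h.ppp.tsum_lintegral hlamb.le (measurableSet_compl_cell lamb) hk
      fun x hx => Set.indicator_of_notMem hx _]
    exact ENNReal.mul_ne_top (ENNReal.mul_ne_top ofReal_ne_top
      (lintegral_compl_cell_rpow_ne_top hlamb htau)) (h.lintegral_mark_ne_top hlaw (by linarith))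
  filter_upwards [ae_lt_top (Measurable.tsum hmeas) htot,
    h.ae_interferenceTerm_nonneg (tau := tau) hlaw] with ω h1 h2
  refine (ENNReal.summable_toReal h1.ne).congr fun j => ?_
  exact toReal_ofReal (h2 j)

theorem markTransform_le_one (h : IsUplinkModel P X L G lamb law)
    (hlaw : IsGammaMixture law c β θ) (hs : 0 < s) {r : ℝ} (hr : 0 ≤ r) :
    markTransform lamb tau s law r ≤ 1 := by
  have := h.isProbabilityMeasure_fading
  have := h.isProbabilityMeasure_link
  calc markTransform lamb tau s law r
      ≤ ∫⁻ _, 1 ∂((cellularLinkLaw lamb).prod law) := by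
        refine lintegral_mono_ae ?_
        filter_upwards [h.ae_mark hlaw] with p hp
        rw [ENNReal.ofReal_le_one, Real.exp_le_one_iff, neg_nonpos]
        exact mul_nonneg hs.le (mul_nonneg (mul_nonneg (Real.rpow_nonneg hp.1 _) hp.2.2)
          (Real.rpow_nonneg hr _))
    _ = 1 := by simp

/-- This is 1 - e^{-y} ≤ y averaged over the mark; it provides the decay that makes (1-φ(r))r
integrable. -/
theorem one_sub_markTransform_le (h : IsUplinkModel P X L G lamb law) (hs : 0 < s) {r : ℝ}
    (hr : 0 ≤ r) :
    1 - markTransform lamb tau s law r ≤ ENNReal.ofReal s *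
      (∫⁻ p, ENNReal.ofReal (p.1 ^ tau * p.2) ∂((cellularLinkLaw lamb).prod law)) *
        ENNReal.ofReal (r ^ (-tau)) := by
  have := h.isProbabilityMeasure_fading
  have := h.isProbabilityMeasure_link
  rw [tsub_le_iff_left, mul_right_comm, ← lintegral_const_mul' _ _
    (ENNReal.mul_ne_top ofReal_ne_top ofReal_ne_top), markTransform,
    ← lintegral_add_left (by fun_prop)]
  calc (1 : ℝ≥0∞) = ∫⁻ _, 1 ∂((cellularLinkLaw lamb).prod law) := by simp
    _ ≤ _ := by
      refine lintegral_mono fun p => ?_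
      rw [← ENNReal.ofReal_mul hs.le,
        ← ENNReal.ofReal_mul (mul_nonneg hs.le (Real.rpow_nonneg hr _))]
      -- Subadditivity of `ENNReal.ofReal` needs no signs, so the bound holds for every mark,
      -- without discarding a null set.
      refine le_trans ?_ ENNReal.ofReal_add_le
      rw [ENNReal.one_le_ofReal]
      have := Real.add_one_le_exp (-(s * (p.1 ^ tau * p.2 * r ^ (-tau))))
      linarith

/-- The Laplace transform of the interference in terms of the Laplace functional of the point
process. -/
theorem lintegral_exp_interference (h : IsUplinkModel P X L G lamb law)
    (hlaw : IsGammaMixture law c β θ) (hlamb : 0 < lamb) (htau : 2 < tau) (hs : 0 < s) :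
    ∫⁻ ω, ENNReal.ofReal (Real.exp (-(s * interference X L G lamb tau ω))) ∂P =
      expNeg (ENNReal.ofReal lamb * ∫⁻ x : Plane,
        (cell lamb)ᶜ.indicator (fun x => 1 - markTransform lamb tau s law ‖x‖) x) := by
  have := h.isProbabilityMeasure_fading
  have := h.isProbabilityMeasure_link
  let g : Plane × (ℝ × ℝ) → ℝ≥0∞ := fun q => ENNReal.ofReal (Real.exp (-(s *
    (cell lamb)ᶜ.indicator (fun x => q.2.1 ^ tau * q.2.2 * ‖x‖ ^ (-tau)) q.1)))
  have hg : Measurable g := by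
    have h1 : Measurable fun q : Plane × (ℝ × ℝ) =>
        (cell lamb)ᶜ.indicator (fun x => q.2.1 ^ tau * q.2.2 * ‖x‖ ^ (-tau)) q.1 := by
      have h2 : Measurable ((Prod.fst ⁻¹' (cell lamb)ᶜ : Set (Plane × (ℝ × ℝ))).indicator
          fun q : Plane × (ℝ × ℝ) => q.2.1 ^ tau * q.2.2 * ‖q.1‖ ^ (-tau)) :=
        Measurable.indicator (by fun_prop) (measurable_fst (measurableSet_compl_cell lamb))
      exact h2
    exact ((h1.const_mul s).neg.exp).ennreal_ofReal
  let ψ : Plane → ℝ≥0∞ := fun x => ∫⁻ z, g (x, z) ∂((cellularLinkLaw lamb).prod law)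
  have hψm : Measurable ψ := hg.lintegral_prod_right'
  have hψ_in : ∀ x ∈ (cell lamb)ᶜ, ψ x = markTransform lamb tau s law ‖x‖ := by
    intro x hx
    simp only [ψ, g, markTransform, Set.indicator_of_mem hx]
  have hψ_out : ∀ x ∉ (cell lamb)ᶜ, ψ x = 1 := by
    intro x hx
    simp [ψ, g, Set.indicator_of_notMem hx]
  have hψ1 : ∀ x, ψ x ≤ 1 := by
    intro x
    by_cases hx : x ∈ (cell lamb)ᶜ
    · rw [hψ_in x hx]
      exact h.markTransform_le_one hlaw hs (norm_nonneg _)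
    · exact (hψ_out x hx).le
  -- The averaged mark factor is written as e^{-f}, so that its product over the points becomes a
  -- Laplace functional. Since ψ = 1 on the cell, f vanishes there, where the points are
  -- unconstrained.
  let f : Plane → ℝ≥0∞ := fun x => (-(ENNReal.log (ψ x))).toENNReal
  have hfm : Measurable f := (hψm.ennreal_log.neg).ereal_toENNReal
  have hf : ∀ x, expNeg (f x) = ψ x := fun x => expNeg_toENNReal_neg_log (hψ1 x)
  have hfD : ∀ x, x ∉ (cell lamb)ᶜ → f x = 0 := by
    intro x hx
    simp [f, hψ_out x hx]
  have hm : ∀ j, Measurable fun ω => (L j ω, G j ω) := fun j =>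
    (h.measurable_link j).prodMk (h.measurable_fading j)
  have hfinite : ∀ N, ∫⁻ ω, ∏ j ∈ Finset.range N, g (X j ω, (L j ω, G j ω)) ∂P =
      ∫⁻ ω, ∏ j ∈ Finset.range N, ψ (X j ω) ∂P := fun N =>
    lintegral_prod_marks h.ppp.measurable hm h.map_mark h.marks_indep h.marks_indep_points hg N
  have hgterm : ∀ j ω, g (X j ω, (L j ω, G j ω)) =
      ENNReal.ofReal (Real.exp (-(s * interferenceTerm X L G lamb tau j ω))) := fun j ω => rfl
  have hleft : Filter.Tendsto
      (fun N => ∫⁻ ω, ∏ j ∈ Finset.range N, g (X j ω, (L j ω, G j ω)) ∂P) Filter.atTop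
      (𝓝 (∫⁻ ω, ENNReal.ofReal (Real.exp (-(s * interference X L G lamb tau ω))) ∂P)) := by
    refine tendsto_lintegral_of_dominated_convergence (fun _ => 1) (fun N => ?_) (fun N => ?_)
      (by simp) ?_
    · exact Finset.measurable_prod _ fun j _ => hg.comp ((h.ppp.measurable j).prodMk (hm j))
    · filter_upwards [h.ae_interferenceTerm_nonneg (tau := tau) hlaw] with ω hω
      refine Finset.prod_le_one' fun j _ => ?_
      rw [hgterm, ENNReal.ofReal_le_one, Real.exp_le_one_iff, neg_nonpos]
      exact mul_nonneg hs.le (hω j)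
    -- Almost sure summability is essential here: a divergent real `tsum` would be 0, and the
    -- partial sums would not converge to `interference`.
    · filter_upwards [h.ae_summable hlaw hlamb htau] with ω hω
      have hprod : ∀ N, ∏ j ∈ Finset.range N, g (X j ω, (L j ω, G j ω)) = ENNReal.ofReal
          (Real.exp (-(s * ∑ j ∈ Finset.range N, interferenceTerm X L G lamb tau j ω))) := by
        intro N
        simp only [hgterm]
        rw [← ENNReal.ofReal_prod_of_nonneg fun _ _ => (Real.exp_pos _).le, ← Real.exp_sum,
          Finset.mul_sum, Finset.sum_neg_distrib]
      simp only [hprod]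
      refine ENNReal.tendsto_ofReal ((Real.continuous_exp.tendsto _).comp ?_)
      exact (hω.hasSum.tendsto_sum_nat.const_mul s).neg
  have hright : Filter.Tendsto (fun N => ∫⁻ ω, ∏ j ∈ Finset.range N, ψ (X j ω) ∂P) Filter.atTop
      (𝓝 (∫⁻ ω, expNeg (∑' j, f (X j ω)) ∂P)) := by
    refine tendsto_lintegral_of_dominated_convergence (fun _ => 1) (fun N => ?_) (fun N => ?_)
      (by simp) (Filter.Eventually.of_forall fun ω => ?_)
    · exact Finset.measurable_prod _ fun j _ => hψm.comp (h.ppp.measurable j)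
    · exact Filter.Eventually.of_forall fun ω => Finset.prod_le_one' fun j _ => hψ1 _
    · simp only [← hf, ← expNeg_sum]
      exact (continuous_expNeg.tendsto _).comp
        ENNReal.summable.hasSum.tendsto_sum_nat
  rw [tendsto_nhds_unique hleft (by simpa only [hfinite] using hright),
    h.ppp.lintegral_expNeg_tsum hlamb.le hfm hfD]
  congr 2
  refine lintegral_congr fun x => ?_
  rw [hf]
  by_cases hx : x ∈ (cell lamb)ᶜ
  · rw [Set.indicator_of_mem hx, hψ_in x hx]
  · rw [Set.indicator_of_notMem hx, hψ_out x hx, tsub_self]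

/-- The Laplace transform of the interference, in terms of the mark transform. -/
theorem laplaceTransform_interference (h : IsUplinkModel P X L G lamb law)
    (hlaw : IsGammaMixture law c β θ) (hlamb : 0 < lamb) (htau : 2 < tau) (hs : 0 < s) :
    IntegrableOn (fun r => (1 - (markTransform lamb tau s law r).toReal) * r)
      (Set.Ioi (cellRadius lamb)) ∧
    laplaceTransform P (interference X L G lamb tau) s =
      Real.exp (-(2 * Real.pi * lamb * ∫ r in Set.Ioi (cellRadius lamb),
        (1 - (markTransform lamb tau s law r).toReal) * r)) := by
  have := h.isProbabilityMeasure_fading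
  have := h.isProbabilityMeasure_link
  let F : ℝ → ℝ := fun r => 1 - (markTransform lamb tau s law r).toReal
  have hFm : Measurable F := measurable_const.sub (measurable_markTransform _ _ _ _).ennreal_toReal
  have hle : ∀ r : ℝ, 0 ≤ r → markTransform lamb tau s law r ≤ 1 := fun r hr =>
    h.markTransform_le_one hlaw hs hr
  have hF0 : ∀ r : ℝ, 0 ≤ r → 0 ≤ F r := by
    intro r hr
    have := ENNReal.toReal_mono one_ne_top (hle r hr)
    simp only [F]
    simpa using this
  have hFe : ∀ r : ℝ, 0 ≤ r → 1 - markTransform lamb tau s law r = ENNReal.ofReal (F r) := by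
    intro r hr
    rw [ENNReal.ofReal_sub _ toReal_nonneg, ENNReal.ofReal_one,
      ofReal_toReal ((hle r hr).trans_lt one_lt_top).ne]
  have hind : ∀ x : Plane,
      (cell lamb)ᶜ.indicator (fun x => 1 - markTransform lamb tau s law ‖x‖) x =
        ENNReal.ofReal ((Set.Ici (cellRadius lamb)).indicator F ‖x‖) := by
    intro x
    by_cases hx : cellRadius lamb ≤ ‖x‖
    · rw [Set.indicator_of_mem (mem_compl_cell.2 hx), Set.indicator_of_mem (Set.mem_Ici.2 hx),
        hFe _ (norm_nonneg _)]
    · rw [Set.indicator_of_notMem (fun h => hx (mem_compl_cell.1 h)),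
        Set.indicator_of_notMem (fun h => hx (Set.mem_Ici.1 h)), ENNReal.ofReal_zero]
  have hnn : ∀ x : Plane, 0 ≤ (Set.Ici (cellRadius lamb)).indicator F ‖x‖ := fun x =>
    Set.indicator_apply_nonneg fun _ => hF0 _ (norm_nonneg _)
  have hfin : ∫⁻ x : Plane,
      (cell lamb)ᶜ.indicator (fun x => 1 - markTransform lamb tau s law ‖x‖) x ≠ ⊤ := by
    -- The bound 1 - M(r) ≤ C r^{-τ} makes the spatial integral finite, allowing the return from [0,
    -- ∞] to real integrals.
    set C := ENNReal.ofReal s *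
      (∫⁻ p, ENNReal.ofReal (p.1 ^ tau * p.2) ∂((cellularLinkLaw lamb).prod law)) with hC
    have hCt : C ≠ ⊤ := ENNReal.mul_ne_top ofReal_ne_top
      (h.lintegral_mark_ne_top hlaw (by linarith))
    have hb : ∫⁻ x : Plane,
        (cell lamb)ᶜ.indicator (fun x => 1 - markTransform lamb tau s law ‖x‖) x ≤
        ∫⁻ x : Plane, C * (cell lamb)ᶜ.indicator (fun x => ENNReal.ofReal (‖x‖ ^ (-tau))) x := by
      refine lintegral_mono fun x => ?_
      by_cases hx : x ∈ (cell lamb)ᶜ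
      · rw [Set.indicator_of_mem hx, Set.indicator_of_mem hx]
        exact h.one_sub_markTransform_le hs (norm_nonneg _)
      · simp [Set.indicator_of_notMem hx]
    rw [lintegral_const_mul' _ _ hCt] at hb
    exact (hb.trans_lt (ENNReal.mul_ne_top hCt
      (lintegral_compl_cell_rpow_ne_top hlamb htau)).lt_top).ne
  have hmeas : Measurable fun x : Plane => (Set.Ici (cellRadius lamb)).indicator F ‖x‖ :=
    (hFm.indicator measurableSet_Ici).comp measurable_norm
  have hint : Integrable fun x : Plane => (Set.Ici (cellRadius lamb)).indicator F ‖x‖ := by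
    refine ⟨hmeas.aestronglyMeasurable, ?_⟩
    rw [hasFiniteIntegral_iff_ofReal (Filter.Eventually.of_forall hnn)]
    simp_rw [← hind]
    exact hfin.lt_top
  refine ⟨(integral_compl_cell hlamb F).1.1 hint, ?_⟩
  have hI := h.lintegral_exp_interference hlaw hlamb htau hs
  simp_rw [hind] at hI
  have hpos : 0 ≤ ∫ x : Plane, (Set.Ici (cellRadius lamb)).indicator F ‖x‖ :=
    integral_nonneg hnn
  rw [← ofReal_integral_eq_lintegral_ofReal hint (Filter.Eventually.of_forall hnn),
    ← ENNReal.ofReal_mul hlamb.le, expNeg_ofReal (mul_nonneg hlamb.le hpos),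
    (integral_compl_cell hlamb F).2] at hI
  have hterm : ∀ j, Measurable (interferenceTerm X L G lamb tau j) := by
    intro j
    have h2 : Measurable ((X j ⁻¹' (cell lamb)ᶜ).indicator
        fun ω => L j ω ^ tau * G j ω * ‖X j ω‖ ^ (-tau)) := by
      have h3 := h.ppp.measurable j
      have h4 := h.measurable_link j
      have h5 := h.measurable_fading j
      exact Measurable.indicator (by fun_prop) (h3 (measurableSet_compl_cell lamb))
    exact h2
  have hIm : Measurable (interference X L G lamb tau) := Measurable.tsum hterm
  have hexp : Measurable fun ω => Real.exp (-(s * interference X L G lamb tau ω)) :=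
    (hIm.const_mul s).neg.exp
  rw [laplaceTransform, integral_eq_lintegral_of_nonneg_ae
    (Filter.Eventually.of_forall fun ω => (Real.exp_pos _).le) hexp.aestronglyMeasurable, hI,
    toReal_ofReal (Real.exp_pos _).le]
  congr 2
  ring

end IsUplinkModel

/-- The integrability and Laplace transform statements for a complex-valued `φ` that agrees with
the mark transform outside the cell. -/
theorem IsUplinkModel.laplaceTransform_eq_cexp {Ω : Type*} [MeasurableSpace Ω] {P : Measure Ω}
    [IsProbabilityMeasure P] {X : ℕ → Ω → Plane} {L G : ℕ → Ω → ℝ} {lamb tau s : ℝ}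
    {law : Measure ℝ} {c β : ℕ → ℝ} {θ : ℝ} (h : IsUplinkModel P X L G lamb law)
    (hlaw : IsGammaMixture law c β θ) (hlamb : 0 < lamb) (htau : 2 < tau) (hs : 0 < s)
    {φ : ℝ → ℂ}
    (hφ : ∀ r, cellRadius lamb ≤ r → φ r = ((markTransform lamb tau s law r).toReal : ℂ)) :
    IntegrableOn (fun r : ℝ => (1 - φ r) * (r : ℂ)) (Set.Ioi (cellRadius lamb)) ∧
      (laplaceTransform P (interference X L G lamb tau) s : ℂ) =
        Complex.exp (-(2 * Real.pi * lamb *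
          ∫ r : ℝ in Set.Ioi (cellRadius lamb), (1 - φ r) * (r : ℂ))) := by
  obtain ⟨hint, hlap⟩ := h.laplaceTransform_interference hlaw hlamb htau hs
  have heq : ∀ r ∈ Set.Ioi (cellRadius lamb),
      (((1 - (markTransform lamb tau s law r).toReal) * r : ℝ) : ℂ) = (1 - φ r) * (r : ℂ) := by
    intro r hr
    rw [hφ r (le_of_lt hr)]
    push_cast
    rfl
  refine ⟨IntegrableOn.congr_fun (Integrable.ofReal hint) heq measurableSet_Ioi, ?_⟩
  rw [← setIntegral_congr_fun measurableSet_Ioi heq, integral_complex_ofReal, hlap]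
  push_cast
  rfl

/-! ### Identification of φ with the mark transform -/

section Phi

variable {kappa eta mu w lamb tau s r : ℝ}

theorem kappaMuArg_pos (hk : 0 < kappa) (hmu : 0 < mu) (hw : 0 < w) (hlamb : 0 < lamb)
    (hs : 0 < s) (hr : 0 < r) : 0 < kappaMuArg kappa mu w lamb tau s r := by
  have := Real.pi_pos
  unfold kappaMuArg
  positivity

theorem inv_kappaMuArg :
    (kappaMuArg kappa mu w lamb tau s r)⁻¹ = phiLimit lamb tau s (mu * (1 + kappa) / w) r := by
  rw [kappaMuArg, phiLimit]
  congr 1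
  ring

/-- The Γ(n+μ) produced by the Meijer function cancels the one in the coefficient, leaving the
Poisson weight without its e^{-μκ}; that factor is the prefactor in φ. -/
theorem kappaMuTerm_eq (hk : 0 < kappa) (hmu : 0 < mu) (hw : 0 < w) (hlamb : 0 < lamb)
    (htau : 0 < tau) (hs : 0 < s) (hr : 0 < r) (n : ℕ) :
    kappaMuTerm kappa mu w lamb tau s r n =
      ((Real.exp (mu * kappa) * (kappaMuWeight kappa mu n * incompleteBeta (2 / tau) (n + mu)
        (phiLimit lamb tau s (mu * (1 + kappa) / w) r)) : ℝ) : ℂ) := by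
  rw [kappaMuTerm, meijerG_eq (by positivity) (by positivity)
    (kappaMuArg_pos hk hmu hw hlamb hs hr), inv_kappaMuArg, ← Complex.ofReal_mul, kappaMuWeight,
    Real.exp_neg, add_comm mu]
  have hG : Real.Gamma (n + mu) ≠ 0 := (Real.Gamma_pos_of_pos (by positivity)).ne'
  congr 1
  field_simp

theorem etaMuArg_pos (he : 0 < eta) (hmu : 0 < mu) (hw : 0 < w) (hlamb : 0 < lamb)
    (hs : 0 < s) (hr : 0 < r) : 0 < etaMuArg eta mu w lamb tau s r := by
  have := Real.pi_pos
  have := etaMuh_pos he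
  unfold etaMuArg
  positivity

theorem inv_etaMuArg :
    (etaMuArg eta mu w lamb tau s r)⁻¹ = phiLimit lamb tau s (2 * mu * etaMuh eta / w) r := by
  rw [etaMuArg, phiLimit]
  congr 1
  ring

/-- Here the Meijer function produces Γ(2n+2μ); duplication cancels Γ(n+μ+1/2) and the power of 2,
leaving the Γ(n+μ) of the mixture weight. The constant is absorbed by the prefactor of φ. -/
theorem etaMuTerm_eq (he : 0 < eta) (hmu : 0 < mu) (hw : 0 < w) (hlamb : 0 < lamb)
    (htau : 0 < tau) (hs : 0 < s) (hr : 0 < r) (n : ℕ) :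
    etaMuTerm eta mu w lamb tau s r n =
      ((Real.Gamma mu * etaMuh eta ^ mu / (2 * √Real.pi) * (etaMuWeight eta mu n *
        incompleteBeta (2 / tau) (2 * n + 2 * mu)
          (phiLimit lamb tau s (2 * mu * etaMuh eta / w) r)) : ℝ) : ℂ) := by
  have hh := Real.rpow_pos_of_pos (etaMuh_pos he) mu
  have hGm := Real.Gamma_pos_of_pos hmu
  have hpi := Real.sqrt_pos.2 Real.pi_pos
  rw [etaMuTerm, meijerG_eq (by positivity) (by positivity)
    (etaMuArg_pos he hmu hw hlamb hs hr), inv_etaMuArg, ← Complex.ofReal_mul, etaMuWeight,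
    show mu + n + 1 / 2 = n + mu + 1 / 2 by ring,
    show -2 * (n : ℝ) - 2 * mu = -(2 * n + 2 * mu) by ring, Real.rpow_neg two_pos.le]
  have hG : 0 < Real.Gamma (n + mu + 1 / 2) := Real.Gamma_pos_of_pos (by positivity)
  have h2 : (0 : ℝ) < 2 ^ (2 * (n : ℝ) + 2 * mu) := by positivity
  have key : Real.Gamma (2 * n + 2 * mu) = Real.Gamma (n + mu) * Real.Gamma (n + mu + 1 / 2) *
      (2 : ℝ) ^ (2 * (n : ℝ) + 2 * mu) / (2 * √Real.pi) := by
    rw [_root_.eq_div_iff (by positivity), ← Gamma_two_mul_add]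
    ring
  rw [key]
  congr 1
  field_simp

variable {Ω : Type*} [MeasurableSpace Ω] {P : Measure Ω} [IsProbabilityMeasure P]
  {X : ℕ → Ω → Plane} {L G : ℕ → Ω → ℝ}

/-- Convergence of the series comes for free: its terms are nonnegative and sum, up to a positive
factor, to M(r) ≤ 1. -/
theorem IsUplinkModel.summable_kappaMuTerm
    (h : IsUplinkModel P X L G lamb (kappaMuLaw kappa mu w)) (hk : 0 < kappa) (hmu : 0 < mu)
    (hw : 0 < w) (hlamb : 0 < lamb) (htau : 0 < tau) (hs : 0 < s) (hr : 0 < r) :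
    Summable (kappaMuTerm kappa mu w lamb tau s r) ∧
      phiKappaMu kappa mu w lamb tau s r =
        ((markTransform lamb tau s (kappaMuLaw kappa mu w) r).toReal : ℂ) := by
  have := h.isProbabilityMeasure_fading
  have hmix := isGammaMixture_kappaMuLaw hk hmu hw
  obtain ⟨h1, h2⟩ := hmix.hasSum_markTransform hlamb htau hs hr
    ((h.markTransform_le_one hmix hs hr.le).trans_lt one_lt_top).ne
  have hterm : kappaMuTerm kappa mu w lamb tau s r = _ :=
    funext fun n => kappaMuTerm_eq hk hmu hw hlamb htau hs hr n
  constructor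
  · rw [hterm]
    exact Complex.summable_ofReal.2 (h1.mul_left _)
  · rw [phiKappaMu, hterm, ← Complex.ofReal_tsum, tsum_mul_left, ← Complex.ofReal_mul, h2,
      phiFactor, show mu * (1 + kappa) / (s * w) = mu * (1 + kappa) / w / s by field_simp]
    congr 1
    field_simp

theorem IsUplinkModel.summable_etaMuTerm
    (h : IsUplinkModel P X L G lamb (etaMuLaw eta mu w)) (he : 0 < eta) (hmu : 0 < mu)
    (hw : 0 < w) (hlamb : 0 < lamb) (htau : 0 < tau) (hs : 0 < s) (hr : 0 < r) :
    Summable (etaMuTerm eta mu w lamb tau s r) ∧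
      phiEtaMu eta mu w lamb tau s r =
        ((markTransform lamb tau s (etaMuLaw eta mu w) r).toReal : ℂ) := by
  have := h.isProbabilityMeasure_fading
  have hmix := isGammaMixture_etaMuLaw he hmu hw
  obtain ⟨h1, h2⟩ := hmix.hasSum_markTransform hlamb htau hs hr
    ((h.markTransform_le_one hmix hs hr.le).trans_lt one_lt_top).ne
  have hterm : etaMuTerm eta mu w lamb tau s r = _ :=
    funext fun n => etaMuTerm_eq he hmu hw hlamb htau hs hr n
  have hh := Real.rpow_pos_of_pos (etaMuh_pos he) mu
  have hGm := Real.Gamma_pos_of_pos hmu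
  have hpi := Real.sqrt_pos.2 Real.pi_pos
  constructor
  · rw [hterm]
    exact Complex.summable_ofReal.2 (h1.mul_left _)
  · rw [phiEtaMu, hterm, ← Complex.ofReal_tsum, tsum_mul_left, ← Complex.ofReal_mul, h2,
      phiFactor, show 2 * mu * etaMuh eta / (s * w) = 2 * mu * etaMuh eta / w / s by field_simp,
      -- Splitting π^{3/2} as π√π cancels the √π left by duplication.
      show (3 / 2 : ℝ) = 1 + 1 / 2 by norm_num, Real.rpow_add Real.pi_pos, Real.rpow_one,
      ← Real.sqrt_eq_rpow]
    congr 1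
    field_simp

end Phi

/-! ### The main theorem -/

theorem mainTheorem5 {Ω : Type*} [MeasurableSpace Ω] (P : MeasureTheory.Measure Ω)
    [MeasureTheory.IsProbabilityMeasure P]
    (X : ℕ → Ω → Plane) (L G : ℕ → Ω → ℝ) (lamb tau mu w s : ℝ)
    (hlamb : 0 < lamb) (htau : 2 < tau) (hmu : 0 < mu) (hw : 0 < w) (hs : 0 < s) :
    (∀ kappa : ℝ, 0 < kappa → IsUplinkModel P X L G lamb (kappaMuLaw kappa mu w) →
      (∀ᵐ ω ∂P, Summable fun j => interferenceTerm X L G lamb tau j ω) ∧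
      (∀ r : ℝ, cellRadius lamb ≤ r →
        (∀ n : ℕ, MeijerGWellDefined 2 1 (upperParams (2 / tau)) (lowerParams (2 / tau) (n + mu))
          (kappaMuArg kappa mu w lamb tau s r : ℂ)) ∧
        Summable (kappaMuTerm kappa mu w lamb tau s r)) ∧
      MeasureTheory.IntegrableOn
        (fun r : ℝ => (1 - phiKappaMu kappa mu w lamb tau s r) * (r : ℂ))
        (Set.Ioi (cellRadius lamb)) ∧
      (laplaceTransform P (interference X L G lamb tau) s : ℂ) =
        Complex.exp (-(2 * Real.pi * lamb *
          ∫ r : ℝ in Set.Ioi (cellRadius lamb),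
            (1 - phiKappaMu kappa mu w lamb tau s r) * (r : ℂ)))) ∧
    (∀ eta : ℝ, 0 < eta → IsUplinkModel P X L G lamb (etaMuLaw eta mu w) →
      (∀ᵐ ω ∂P, Summable fun j => interferenceTerm X L G lamb tau j ω) ∧
      (∀ r : ℝ, cellRadius lamb ≤ r →
        (∀ n : ℕ, MeijerGWellDefined 2 1 (upperParams (2 / tau))
          (lowerParams (2 / tau) (2 * n + 2 * mu)) (etaMuArg eta mu w lamb tau s r : ℂ)) ∧
        Summable (etaMuTerm eta mu w lamb tau s r)) ∧
      MeasureTheory.IntegrableOn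
        (fun r : ℝ => (1 - phiEtaMu eta mu w lamb tau s r) * (r : ℂ))
        (Set.Ioi (cellRadius lamb)) ∧
      (laplaceTransform P (interference X L G lamb tau) s : ℂ) =
        Complex.exp (-(2 * Real.pi * lamb *
          ∫ r : ℝ in Set.Ioi (cellRadius lamb),
            (1 - phiEtaMu eta mu w lamb tau s r) * (r : ℂ)))) := by
  have htau0 : 0 < tau := by linarith
  have hd : 0 < 2 / tau := by positivity
  have hR := cellRadius_pos hlamb
  refine ⟨fun kappa hk h => ?_, fun eta he h => ?_⟩
  · have hmix := isGammaMixture_kappaMuLaw hk hmu hw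
    have hsum := fun r (hr : cellRadius lamb ≤ r) =>
      h.summable_kappaMuTerm hk hmu hw hlamb htau0 hs (hR.trans_le hr)
    refine ⟨h.ae_summable hmix hlamb htau, fun r hr => ⟨fun n => ?_, (hsum r hr).1⟩, ?_⟩
    · exact meijerGWellDefined hd (by positivity)
        (kappaMuArg_pos hk hmu hw hlamb hs (hR.trans_le hr))
    · exact h.laplaceTransform_eq_cexp hmix hlamb htau hs fun r hr => (hsum r hr).2
  · have hmix := isGammaMixture_etaMuLaw he hmu hw
    have hsum := fun r (hr : cellRadius lamb ≤ r) =>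
      h.summable_etaMuTerm he hmu hw hlamb htau0 hs (hR.trans_le hr)
    refine ⟨h.ae_summable hmix hlamb htau, fun r hr => ⟨fun n => ?_, (hsum r hr).1⟩, ?_⟩
    · exact meijerGWellDefined hd (by positivity)
        (etaMuArg_pos he hmu hw hlamb hs (hR.trans_le hr))
    · exact h.laplaceTransform_eq_cexp hmix hlamb htau hs fun r hr => (hsum r hr).2
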